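/- Let $\mathbb S^3\times\mathbb R=\{(x_1,\dots,x_5)\in\mathbb E^5 : x_1^2+x_2^2+x_3^2+x_4^2=1\}$, let $M$ be a smooth $3$-manifold and $x:M\to\mathbb S^3\times\mathbb R\subset\mathbb E^5$ a smooth immersed hypersurface, oriented by a smooth unit normal vector field $N$ (tangent to $\mathbb S^3\times\mathbb R$), with shape operator $S$. Let $T$ be the tangential component of $\partial/\partial x_5$, i.e. $\partial/\partial x_5=T+\sigma N$ along $M$ with $T$ tangent to $M$, and assume that $T$ vanishes nowhere. Suppose that $M$ has three principal curvatures $k_1,k_2,k_3$ that are distinct at every point, that $ST=k_1T$, and that there are functions $f_1,f_2:\mathbb R\to\mathbb R$ with $k_2=f_1(k_1)$ and $k_3=f_2(k_1)$ on $M$. Then $M$ is locally congruent to a hypersurface of the form $$(s,v,w)\mapsto\bigl(\cos\alpha_1(s)\cos v,\ \cos\alpha_1(s)\sin v,\ \sin\alpha_1(s)\cos w,\ \sin\alpha_1(s)\sin w,\ \alpha_2(s)\bigr),$$ where $\alpha_1,\alpha_2$ are smooth functions on an open interval $I$ with $\alpha_1'^2+\alpha_2'^2=1$, $\cos\alpha_1>0$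 and $\sin\alpha_1>0$. That is, every point of $M$ has a neighbourhood with smooth local coordinates $(s,v,w)$, $s\in I$, in which the composition of $x$ with a suitable isometry of $\mathbb S^3\times\mathbb R$ is the map above for some such $I,\alpha_1,\alpha_2$. -/

import Mathlib

open scoped Manifold ContDiff

noncomputable section

namespace S3R

/-- The Euclidean space `𝔼ⁿ`. -/
abbrev E (n : ℕ) : Type := EuclideanSpace ℝ (Fin n)

/-- `𝕊³ × ℝ ⊂ 𝔼⁵`. The last coordinate (index `4`) is the `ℝ`-factor. -/
def product : Set (E 5) := {y | y 0 ^ 2 + y 1 ^ 2 + y 2 ^ 2 + y 3 ^ 2 = 1}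

/-- The unit normal of `𝕊³ × ℝ` in `𝔼⁵` at the point `y`. -/
def outerNormal (y : E 5) : E 5 := !₂[y 0, y 1, y 2, y 3, 0]

/-- The unit vector `∂/∂t` tangent to the `ℝ`-factor. -/
def dt : E 5 := !₂[0, 0, 0, 0, 1]

section Hypersurface

variable {M : Type*} [TopologicalSpace M] [ChartedSpace (E 3) M]

/-- The differential at `p` of a map from a `3`-manifold to `𝔼⁵`. -/
def diff (f : M → E 5) (p : M) : TangentSpace (𝓡 3) p →L[ℝ] E 5 :=
  mfderiv (𝓡 3) 𝓘(ℝ, E 5) f p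

/-- `x : M → 𝕊³ × ℝ ⊂ 𝔼⁵` is a smooth immersed hypersurface, oriented by the smooth unit normal
vector field `N`, which is tangent to `𝕊³ × ℝ` and orthogonal to `M`. -/
structure IsOrientedHypersurface (x N : M → E 5) : Prop where
  smooth : ContMDiff (𝓡 3) 𝓘(ℝ, E 5) ∞ x
  immersion : ∀ p, Function.Injective (diff x p)
  mem_product : ∀ p, x p ∈ product
  smooth_normal : ContMDiff (𝓡 3) 𝓘(ℝ, E 5) ∞ N
  norm_normal : ∀ p, ‖N p‖ = 1
  normal_tangent_product : ∀ p, inner ℝ (N p) (outerNormal (x p)) = 0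
  normal_orthogonal : ∀ p (X : TangentSpace (𝓡 3) p), inner ℝ (N p) (diff x p X) = 0

/-- The component of a vector of `𝔼⁵` tangent to the immersed hypersurface `x` at `p`, as an
element of the tangent space of `M`: orthogonal projection to the image of the (injective)
differential of `x`, followed by the inverse of the differential. -/
def tangentPart (x : M → E 5) (p : M) : E 5 →ₗ[ℝ] TangentSpace (𝓡 3) p :=
  (diff x p).toLinearMap.leftInverse ∘ₗ
    ((LinearMap.range (diff x p).toLinearMap).starProjection : E 5 →L[ℝ] E 5).toLinearMap

/-- For an immersion, `tangentPart x p v` is the tangent vector whose image under the differential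
is the orthogonal projection of `v`. -/
theorem diff_tangentPart {x : M → E 5} {p : M} (h : Function.Injective (diff x p)) (v : E 5) :
    diff x p (tangentPart x p v) =
      (LinearMap.range (diff x p).toLinearMap).starProjection v := by
  obtain ⟨X, hX⟩ :=
    (LinearMap.range (diff x p).toLinearMap).starProjection_apply_mem v
  have hk : LinearMap.ker (diff x p).toLinearMap = ⊥ := LinearMap.ker_eq_bot.2 h
  have h2 : tangentPart x p v = X := by
    change (diff x p).toLinearMap.leftInverse
      ((LinearMap.range (diff x p).toLinearMap).starProjection v) = X
    rw [← hX]
    exact LinearMap.leftInverse_apply_of_inj hk X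
  rw [h2]
  exact hX

/-- The shape operator of `M` in `𝕊³ × ℝ` with respect to `N`: by the Weingarten formula
`S X = - ∇̃_X N`, where `∇̃_X N` is tangent to `M`, hence equal to the component tangent to `M` of
the derivative of `N` in `𝔼⁵`. -/
def shapeOperator (x N : M → E 5) (p : M) : Module.End ℝ (TangentSpace (𝓡 3) p) :=
  -(tangentPart x p ∘ₗ (diff N p).toLinearMap)

/-- The tangential component `T` of `∂/∂t`, that is, `∂/∂t = T + σ N`. -/
def heightField (x : M → E 5) (p : M) : TangentSpace (𝓡 3) p := tangentPart x p dt

end Hypersurface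

/-- The map `(s, v, w) ↦ (cos α₁ cos v, cos α₁ sin v, sin α₁ cos w, sin α₁ sin w, α₂)`, with
`α₁, α₂` evaluated at `s`. -/
def torusMap (α₁ α₂ : ℝ → ℝ) (y : E 3) : E 5 :=
  !₂[Real.cos (α₁ (y 0)) * Real.cos (y 1), Real.cos (α₁ (y 0)) * Real.sin (y 1),
    Real.sin (α₁ (y 0)) * Real.cos (y 2), Real.sin (α₁ (y 0)) * Real.sin (y 2), α₂ (y 0)]

/-- Admissible data `α₁, α₂` for `torusMap`, on an open interval `I`. -/
structure IsProfile (I : Set ℝ) (α₁ α₂ : ℝ → ℝ) : Prop where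
  isOpen : IsOpen I
  interval : I.OrdConnected
  smooth_left : ContDiffOn ℝ ∞ α₁ I
  smooth_right : ContDiffOn ℝ ∞ α₂ I
  unit_speed : ∀ s ∈ I, deriv α₁ s ^ 2 + deriv α₂ s ^ 2 = 1
  cos_pos : ∀ s ∈ I, 0 < Real.cos (α₁ s)
  sin_pos : ∀ s ∈ I, 0 < Real.sin (α₁ s)

/-- `x` is locally congruent to a hypersurface of the family `torusMap`: around each point `p` there
are a smooth chart `φ = (s, v, w)` of `M`, an isometry `Φ` of `𝕊³ × ℝ` (the restriction of an
isometry of `𝔼⁵`) and admissible `α₁, α₂` such that `Φ ∘ x` is `torusMap α₁ α₂` in these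
coordinates. -/
def LocallyCongruentToTorusMap {M : Type*} [TopologicalSpace M] [ChartedSpace (E 3) M]
    (x : M → E 5) : Prop :=
  ∀ p : M, ∃ (φ : OpenPartialHomeomorph M (E 3)) (Φ : E 5 ≃ᵃⁱ[ℝ] E 5) (I : Set ℝ) (α₁ α₂ : ℝ → ℝ),
    φ ∈ IsManifold.maximalAtlas (𝓡 3) ∞ M ∧ p ∈ φ.source ∧
    Φ '' product = product ∧ IsProfile I α₁ α₂ ∧
    ∀ q ∈ φ.source, φ q 0 ∈ I ∧ Φ (x q) = torusMap α₁ α₂ (φ q)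

end S3R

end

/-! Write `x = P + h ∂/∂t` and `N = Q + σ ∂/∂t`, with `P`, `Q` orthogonal to `∂/∂t`. `T` is the
gradient of the height `h`, and the gradient of `σ` is `-S T = -k₁ T`, so locally `σ = F(h)` and `k₁
= -F'(h)` (`exists_factor`, `curvature_eq`). Hence `k₂` and `k₃`, being functions of `k₁`, are
constant on each slice `h = const`; no regularity of `f₁`, `f₂` is needed for this.

A slice is a surface in `𝕊³` with unit normal `n = rQ`, `r = (1 - σ²)^(-1/2)`, and constant distinct
principal curvatures `l = r k₂`, `m = r k₃`. Along `T` the orthonormal pair `(P, n)` merely rotates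
in its own plane, by an angle `β(h)`; undoing the rotation transports everything to the slice
through the base point `q`. There `V = mP + n` and `W = lP + n` are multiples of the two focal maps:
`V` is constant in the third principal direction, `W` in the second. So `V` and `W` take their
values independently of each other (`exists_product_neighbourhood`), while `⟨V, W⟩ = 1 + lm` at
every point. Consequently every value of `V` has the same inner product with every value of `W`. As
three distinct points of a sphere are never collinear, this puts the values of `V` and of `W` in two
orthogonal planes (`exists_adapted_basis`) and forces `1 + lm = 0`.

Solving for `P` gives `P = cos(θ - β) V̂ + sin(θ - β) Ŵ`, where `V̂`, `Ŵ` run on unit circles of the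
two planes and `tan θ = l` (`exists_planes`). The angles on these circles and the arc length of the
profile curve are the coordinates sought. -/

namespace S3R

/-! ### Calculus: inverse functions, functional dependence, primitives. -/

section Analysis

variable {E F : Type*} [NormedAddCommGroup E] [NormedSpace ℝ E] [FiniteDimensional ℝ E]
  [NormedAddCommGroup F] [NormedSpace ℝ F] [FiniteDimensional ℝ F]

/-- The smooth inverse function theorem, with smoothness of the inverse on a neighbourhood. -/
theorem exists_openPartialHomeomorph {f : E → F} {U : Set E} (hU : IsOpen U)
    (hf : ContDiffOn ℝ ∞ f U) {a : E} (ha : a ∈ U)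
    (hdim : Module.finrank ℝ E = Module.finrank ℝ F)
    (hinj : ∀ X, fderiv ℝ f a X = 0 → X = 0) :
    ∃ ψ : OpenPartialHomeomorph E F, a ∈ ψ.source ∧ ψ.source ⊆ U ∧ (∀ z, ψ z = f z) ∧
      ContDiffOn ℝ ∞ ψ ψ.source ∧ ContDiffOn ℝ ∞ ψ.symm ψ.target := by
  have hE : CompleteSpace E := FiniteDimensional.complete ℝ E
  have hdiff : ∀ z ∈ U, ContDiffAt ℝ ∞ f z := fun z hz => hf.contDiffAt (hU.mem_nhds hz)
  let e : E ≃L[ℝ] F := (LinearEquiv.ofInjectiveOfFinrankEq (fderiv ℝ f a).toLinearMap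
    ((injective_iff_map_eq_zero _).2 hinj) hdim).toContinuousLinearEquiv
  have he : (e : E →L[ℝ] F) = fderiv ℝ f a := by ext; rfl
  have hda : HasFDerivAt f (e : E →L[ℝ] F) a := by
    rw [he]; exact ((hdiff a ha).differentiableAt (by simp)).hasFDerivAt
  let ψ₀ := (hdiff a ha).toOpenPartialHomeomorph f hda (by simp)
  have hcont : ContinuousOn (fderiv ℝ f) U := hf.continuousOn_fderiv_of_isOpen hU (by simp)
  -- Restricting to the open set where the derivative is invertible makes the inverse smooth on the
  -- whole target, not only at the image of `a`.
  have hO : IsOpen (U ∩ fderiv ℝ f ⁻¹' Set.range ((↑) : (E ≃L[ℝ] F) → E →L[ℝ] F)) :=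
    hcont.isOpen_inter_preimage hU ContinuousLinearEquiv.isOpen
  set O := U ∩ fderiv ℝ f ⁻¹' Set.range ((↑) : (E ≃L[ℝ] F) → E →L[ℝ] F)
  refine ⟨ψ₀.restrOpen O hO, ⟨(hdiff a ha).mem_toOpenPartialHomeomorph_source hda (by simp),
    ha, ⟨e, he⟩⟩, fun z hz => hz.2.1, fun z => rfl, ?_, ?_⟩
  · exact hf.mono fun z hz => hz.2.1
  · intro y hy
    have hs := (ψ₀.restrOpen O hO).map_target hy
    obtain ⟨e', he'⟩ := hs.2.2
    refine ContDiffAt.contDiffWithinAt ?_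
    refine OpenPartialHomeomorph.contDiffAt_symm _ (f₀' := e') hy ?_ (hdiff _ hs.2.1)
    rw [he']
    exact ((hdiff _ hs.2.1).differentiableAt (by simp)).hasFDerivAt

/-- A differentiable map whose derivative vanishes in the direction of a segment takes the same
value at both ends. -/
theorem eq_of_fderiv_segment {E F : Type*} [NormedAddCommGroup E] [NormedSpace ℝ E]
    [NormedAddCommGroup F] [NormedSpace ℝ F] {f : E → F} {y z : E}
    (hf : ∀ t ∈ Set.Icc (0 : ℝ) 1, DifferentiableAt ℝ f (y + t • (z - y)))
    (h0 : ∀ t ∈ Set.Icc (0 : ℝ) 1, fderiv ℝ f (y + t • (z - y)) (z - y) = 0) : f z = f y := by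
  have hd : ∀ t ∈ Set.Icc (0 : ℝ) 1, HasDerivAt (fun t : ℝ => f (y + t • (z - y))) 0 t := by
    intro t ht
    have h1 : HasDerivAt (fun t : ℝ => y + t • (z - y)) (z - y) t := by
      simpa using ((hasDerivAt_id t).smul_const (z - y)).const_add y
    have := (hf t ht).hasFDerivAt.comp_hasDerivAt t h1
    rwa [h0 t ht] at this
  have := constant_of_has_deriv_right_zero (f := fun t : ℝ => f (y + t • (z - y))) (a := 0) (b := 1)
    (fun t ht => (hd t ht).continuousAt.continuousWithinAt)
    (fun t ht => (hd t ⟨ht.1, ht.2.le⟩).hasDerivWithinAt) 1 (by simp)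
  simpa using this

/-- If `df = μ dh` and `dh ≠ 0`, then `f` is locally a smooth function of `h`. -/
theorem exists_factor {f h : E → ℝ} {U : Set E} (hU : IsOpen U)
    (hf : ContDiffOn ℝ ∞ f U) (hh : ContDiffOn ℝ ∞ h U) {a : E} (ha : a ∈ U)
    (hne : fderiv ℝ h a ≠ 0)
    (hdf : ∀ z ∈ U, ∀ X, fderiv ℝ h z X = 0 → fderiv ℝ f z X = 0) :
    ∃ (ε : ℝ) (G : ℝ → ℝ), 0 < ε ∧ ContDiffOn ℝ ∞ G (Metric.ball (h a) ε) ∧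
      ∀ᶠ z in nhds a, h z ∈ Metric.ball (h a) ε ∧ f z = G (h z) := by
  obtain ⟨u, hu⟩ : ∃ u, fderiv ℝ h a u = 1 := by
    obtain ⟨w, hw⟩ := DFunLike.ne_iff.1 hne
    exact ⟨(fderiv ℝ h a w)⁻¹ • w, by simpa using inv_mul_cancel₀ hw⟩
  set l := fderiv ℝ h a with hl
  -- `Ψ` replaces the `u`-component of `z` by `h z - h a` and keeps the component in `ker l`. It
  -- turns `h` into `l`, up to a constant, and has derivative the identity at `a`.
  let Ψ : E → E := fun z => (h z - h a) • u + (z - l z • u)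
  have hlΨ : ∀ z, l (Ψ z) = h z - h a := fun z => by simp [Ψ, hu]
  have hΨ : ContDiffOn ℝ ∞ Ψ U := by
    refine ((hh.sub contDiffOn_const).smul contDiffOn_const).add ?_
    exact contDiffOn_id.sub (l.contDiff.contDiffOn.smul contDiffOn_const)
  have hha : HasFDerivAt h l a :=
    ((hh.contDiffAt (hU.mem_nhds ha)).differentiableAt (by simp)).hasFDerivAt
  have hΨa : HasFDerivAt Ψ (ContinuousLinearMap.id ℝ E) a := by
    have := ((hha.sub_const (h a)).smul_const u).add
      ((hasFDerivAt_id a).sub (l.hasFDerivAt.smul_const u))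
    refine this.congr_fderiv ?_
    ext X; simp
  obtain ⟨ψ, haψ, hψU, hψ, hψs, hψt⟩ := exists_openPartialHomeomorph hU hΨ ha rfl
    (fun X hX => by rw [hΨa.fderiv] at hX; simpa using hX)
  have hta : ψ a ∈ ψ.target := ψ.map_source haψ
  obtain ⟨δ, hδ, hball⟩ := Metric.isOpen_iff.1 ψ.open_target _ hta
  let F₀ : E → ℝ := f ∘ ψ.symm
  have hsU : ∀ y ∈ ψ.target, ψ.symm y ∈ U := fun y hy => hψU (ψ.map_target hy)
  have hF₀ : ContDiffOn ℝ ∞ F₀ ψ.target := hf.comp hψt hsU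
  have hlsymm : ∀ y ∈ ψ.target, h (ψ.symm y) = l y + h a := fun y hy => by
    have := hlΨ (ψ.symm y)
    rw [← hψ, ψ.right_inv hy] at this
    linarith
  have hF₀' : ∀ y ∈ ψ.target, ∀ X, l X = 0 → fderiv ℝ F₀ y X = 0 := by
    intro y hy X hX
    have hsd : DifferentiableAt ℝ ψ.symm y :=
      (hψt.contDiffAt (ψ.open_target.mem_nhds hy)).differentiableAt (by simp)
    have hfd := (hf.contDiffAt (hU.mem_nhds (hsU y hy))).differentiableAt (by simp)
    have hhd := (hh.contDiffAt (hU.mem_nhds (hsU y hy))).differentiableAt (by simp)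
    rw [show F₀ = f ∘ ψ.symm from rfl, fderiv_comp _ hfd hsd]
    refine hdf _ (hsU y hy) _ ?_
    have h1 : fderiv ℝ (h ∘ ψ.symm) y = l := by
      have : h ∘ ψ.symm =ᶠ[nhds y] fun y => l y + h a := by
        filter_upwards [ψ.open_target.mem_nhds hy] with y hy using hlsymm y hy
      rw [this.fderiv_eq, fderiv_add_const, l.fderiv]
    rw [fderiv_comp _ hhd hsd] at h1
    have := congrArg (fun L => L X) h1
    simpa [hX] using this
  have hc : Continuous fun t : ℝ => ψ a + (t - h a) • u := by fun_prop
  have hc0 : ψ a + (h a - h a) • u ∈ Metric.ball (ψ a) δ := by simpa using hδ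
  obtain ⟨ε, hε, hεb⟩ := Metric.isOpen_iff.1 (Metric.isOpen_ball.preimage hc) (h a) hc0
  -- `G` is `f` read along the line through `ψ a` in direction `u`. A point `ψ z` and the point of
  -- that line at the same height differ by a vector of `ker l`, and the segment between them stays
  -- in the ball, so `F₀` agrees at both.
  refine ⟨ε, fun t => F₀ (ψ a + (t - h a) • u), hε, ?_, ?_⟩
  · refine hF₀.comp (ContDiff.contDiffOn (by fun_prop)) fun t ht => hball (hεb ht)
  · have hψc : ContinuousAt ψ a := ψ.continuousAt haψ
    filter_upwards [ψ.open_source.mem_nhds haψ, hha.continuousAt (Metric.ball_mem_nhds _ hε),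
      hψc (Metric.ball_mem_nhds _ hδ)] with z hz hzh hzδ
    refine ⟨hzh, ?_⟩
    have h1 := hεb hzh
    set w := ψ a + (h z - h a) • u
    have hseg : ∀ t ∈ Set.Icc (0 : ℝ) 1, w + t • (ψ z - w) ∈ ψ.target := fun t ht =>
      hball ((convex_ball (ψ a) δ).add_smul_sub_mem h1 hzδ ht)
    have hlw : l (ψ z - w) = 0 := by
      simp only [w, map_sub, map_add, map_smul, hψ, hlΨ, hu]; simp
    have := eq_of_fderiv_segment (f := F₀) (y := w) (z := ψ z)
      (fun t ht => (hF₀.contDiffAt (ψ.open_target.mem_nhds (hseg t ht))).differentiableAt (by simp))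
      (fun t ht => hF₀' _ (hseg t ht) _ hlw)
    simpa [F₀, ψ.left_inv hz] using this

/-- A smooth function on an interval has a smooth primitive. -/
theorem exists_primitive {f : ℝ → ℝ} {a ε : ℝ}
    (hf : ContDiffOn ℝ ∞ f (Metric.ball a ε)) :
    ∃ G : ℝ → ℝ, G a = 0 ∧ ContDiffOn ℝ ∞ G (Metric.ball a ε) ∧
      ∀ t ∈ Metric.ball a ε, HasDerivAt G (f t) t := by
  have hd : ∀ t ∈ Metric.ball a ε, HasDerivAt (fun t => ∫ y in a..t, f y) (f t) t := by
    intro t ht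
    have ha : a ∈ Metric.ball a ε := Metric.mem_ball_self ((dist_nonneg).trans_lt ht)
    have hsub : Set.uIcc a t ⊆ Metric.ball a ε :=
      ((convex_ball a ε).ordConnected).uIcc_subset ha ht
    refine intervalIntegral.integral_hasDerivAt_right
      (hf.continuousOn.mono hsub).intervalIntegrable ?_
      (hf.continuousOn.continuousAt (Metric.isOpen_ball.mem_nhds ht))
    exact hf.continuousOn.stronglyMeasurableAtFilter Metric.isOpen_ball t ht
  refine ⟨_, by simp, ?_, hd⟩
  rw [contDiffOn_infty_iff_deriv_of_isOpen Metric.isOpen_ball]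
  exact ⟨fun t ht => (hd t ht).differentiableAt.differentiableWithinAt,
    hf.congr fun t ht => (hd t ht).deriv⟩

end Analysis

/-! ### Linear algebra: orthogonal planes from constant mutual inner products. -/

section Planes

variable {G : Type*} [NormedAddCommGroup G] [InnerProductSpace ℝ G]

/-- Three distinct points of a sphere span a plane; it is orthogonal to every vector which has the
same inner product with the three points. -/
theorem exists_orthonormal_pair {a b c : G} {R : ℝ} (hab : a ≠ b) (hac : a ≠ c) (hbc : b ≠ c)
    (ha : inner ℝ a a = R) (hb : inner ℝ b b = R) (hc : inner ℝ c c = R) :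
    ∃ u w : G, inner ℝ u u = 1 ∧ inner ℝ w w = 1 ∧ inner ℝ u w = 0 ∧
      ∀ z : G, inner ℝ b z = inner ℝ a z → inner ℝ c z = inner ℝ a z →
        inner ℝ u z = 0 ∧ inner ℝ w z = 0 := by
  have hx : b - a ≠ 0 := sub_ne_zero.2 hab.symm
  set u : G := (‖b - a‖)⁻¹ • (b - a) with hu
  have hnx : ‖b - a‖ ≠ 0 := norm_ne_zero_iff.2 hx
  have huu : inner ℝ u u = 1 := by
    simp only [hu, inner_smul_left, inner_smul_right, real_inner_self_eq_norm_sq]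
    simp; field_simp
  set y : G := (c - a) - (inner ℝ u (c - a)) • u with hy
  -- Otherwise `c` lies on the line through `a` and `b`, which meets the sphere only at the
  -- parameters `t = 0` and `t = 1`.
  have hy0 : y ≠ 0 := by
    intro h0
    obtain ⟨t, ht⟩ : ∃ t : ℝ, c = a + t • (b - a) := by
      refine ⟨inner ℝ u (c - a) * (‖b - a‖)⁻¹, ?_⟩
      have := sub_eq_zero.1 h0
      rw [mul_smul, ← hu, ← this]; abel
    have hxx : inner ℝ (b - a) (b - a) ≠ 0 := inner_self_ne_zero.2 hx
    have h1 : 2 * inner ℝ a (b - a) + inner ℝ (b - a) (b - a) = 0 := by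
      have : inner ℝ b b = inner ℝ (a + (b - a)) (a + (b - a)) := by rw [add_sub_cancel]
      rw [hb, real_inner_add_add_self, ha] at this
      linarith
    have h2 : t * (2 * inner ℝ a (b - a) + t * inner ℝ (b - a) (b - a)) = 0 := by
      rw [ht, real_inner_add_add_self, ha, inner_smul_right, inner_smul_left, inner_smul_right] at hc
      simp only [conj_trivial] at hc
      linarith
    have h3 : t * (t - 1) * inner ℝ (b - a) (b - a) = 0 := by linear_combination h2 - t * h1
    rcases mul_eq_zero.1 h3 with h3 | h3
    · rcases mul_eq_zero.1 h3 with h3 | h3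
      · exact hac (by rw [ht, h3]; simp)
      · exact hbc (by rw [ht, sub_eq_zero.1 h3]; simp)
    · exact hxx h3
  have hny : ‖y‖ ≠ 0 := norm_ne_zero_iff.2 hy0
  have huy : inner ℝ u y = 0 := by
    rw [hy, inner_sub_right, inner_smul_right, huu]; simp
  refine ⟨u, (‖y‖)⁻¹ • y, huu, ?_, ?_, ?_⟩
  · simp only [inner_smul_left, inner_smul_right, real_inner_self_eq_norm_sq]
    simp; field_simp
  · rw [inner_smul_right, huy, mul_zero]
  · intro z hbz hcz
    have h1 : inner ℝ u z = 0 := by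
      rw [hu, inner_smul_left, inner_sub_left, hbz, sub_self, mul_zero]
    refine ⟨h1, ?_⟩
    have h2 : inner ℝ y z = 0 := by
      rw [hy, inner_sub_left (c - a), inner_sub_left c, inner_smul_left u z, h1, hcz]
      simp
    rw [inner_smul_left, h2, mul_zero]

theorem orthonormal_of_inner {b : Fin 5 → G} (h0 : inner ℝ (b 0) (b 0) = 1)
    (h1 : inner ℝ (b 1) (b 1) = 1) (h2 : inner ℝ (b 2) (b 2) = 1) (h3 : inner ℝ (b 3) (b 3) = 1)
    (h4 : inner ℝ (b 4) (b 4) = 1) (h01 : inner ℝ (b 0) (b 1) = 0) (h02 : inner ℝ (b 0) (b 2) = 0)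
    (h03 : inner ℝ (b 0) (b 3) = 0) (h04 : inner ℝ (b 0) (b 4) = 0)
    (h12 : inner ℝ (b 1) (b 2) = 0) (h13 : inner ℝ (b 1) (b 3) = 0)
    (h14 : inner ℝ (b 1) (b 4) = 0) (h23 : inner ℝ (b 2) (b 3) = 0)
    (h24 : inner ℝ (b 2) (b 4) = 0) (h34 : inner ℝ (b 3) (b 4) = 0) : Orthonormal ℝ b := by
  rw [orthonormal_iff_ite]
  intro i j
  fin_cases i <;> fin_cases j <;> simp [-inner_self_eq_norm_sq_to_K] <;>
    first | assumption | (rw [real_inner_comm]; assumption)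

theorem exists_orthonormalBasis (b : Fin 5 → E 5) (hb : Orthonormal ℝ b) :
    ∃ B : OrthonormalBasis (Fin 5) ℝ (E 5), ∀ i, B i = b i := by
  refine ⟨OrthonormalBasis.mk hb (hb.linearIndependent.span_eq_top_of_card_eq_finrank' ?_).ge,
    fun i => by rw [OrthonormalBasis.coe_mk]⟩
  simp

/-- Two sets of vectors orthogonal to `e`, each lying on a sphere and having at least three
elements, with all mutual inner products equal, lie in orthogonal planes. -/
theorem exists_adapted_basis {A B : Set (E 5)} {e : E 5} (he : inner ℝ e e = 1) {RA RB c : ℝ}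
    (hRA : RA ≠ 0) (hRB : RB ≠ 0)
    (hA : ∀ a ∈ A, inner ℝ a a = RA ^ 2) (hB : ∀ b ∈ B, inner ℝ b b = RB ^ 2)
    (hAe : ∀ a ∈ A, inner ℝ a e = 0) (hBe : ∀ b ∈ B, inner ℝ b e = 0)
    (hAB : ∀ a ∈ A, ∀ b ∈ B, inner ℝ a b = c)
    (hA3 : ∃ a ∈ A, ∃ a' ∈ A, ∃ a'' ∈ A, a ≠ a' ∧ a ≠ a'' ∧ a' ≠ a'')
    (hB3 : ∃ b ∈ B, ∃ b' ∈ B, ∃ b'' ∈ B, b ≠ b' ∧ b ≠ b'' ∧ b' ≠ b'')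
    {a₀ b₀ : E 5} (ha₀ : a₀ ∈ A) (hb₀ : b₀ ∈ B) :
    c = 0 ∧ ∃ b : OrthonormalBasis (Fin 5) ℝ (E 5), b 0 = RA⁻¹ • a₀ ∧ b 2 = RB⁻¹ • b₀ ∧ b 4 = e ∧
      (∀ a ∈ A, inner ℝ (b 2) a = 0 ∧ inner ℝ (b 3) a = 0) ∧
      (∀ b' ∈ B, inner ℝ (b 0) b' = 0 ∧ inner ℝ (b 1) b' = 0) := by
  obtain ⟨a, ha, a', ha', a'', ha'', h1, h2, h3⟩ := hA3
  obtain ⟨b, hb, b', hb', b'', hb'', h4, h5, h6⟩ := hB3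
  obtain ⟨u, u', huu, huu', hu0, hu⟩ := exists_orthonormal_pair h1 h2 h3 (hA _ ha) (hA _ ha')
    (hA _ ha'')
  obtain ⟨w, w', hww, hww', hw0, hw⟩ := exists_orthonormal_pair h4 h5 h6 (hB _ hb) (hB _ hb')
    (hB _ hb'')
  have huB : ∀ b' ∈ B, inner ℝ u b' = 0 ∧ inner ℝ u' b' = 0 := fun z hz =>
    hu z (by rw [hAB _ ha' _ hz, hAB _ ha _ hz]) (by rw [hAB _ ha'' _ hz, hAB _ ha _ hz])
  have hAB' : ∀ a ∈ A, ∀ b ∈ B, inner ℝ b a = c := fun a ha b hb => by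
    rw [real_inner_comm]; exact hAB a ha b hb
  have hwA : ∀ a ∈ A, inner ℝ w a = 0 ∧ inner ℝ w' a = 0 := fun z hz =>
    hw z (by rw [hAB' _ hz _ hb', hAB' _ hz _ hb]) (by rw [hAB' _ hz _ hb'', hAB' _ hz _ hb])
  have hue := hu e (by rw [hAe _ ha', hAe _ ha]) (by rw [hAe _ ha'', hAe _ ha])
  have hwe := hw e (by rw [hBe _ hb', hBe _ hb]) (by rw [hBe _ hb'', hBe _ hb])
  -- All elements of `B` have inner product zero with `u`, in particular the same one, so `u` itself
  -- qualifies as a vector orthogonal to the plane of `w`, `w'`.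
  have hwu := hw u (by rw [real_inner_comm, (huB _ hb').1, real_inner_comm, (huB _ hb).1])
    (by rw [real_inner_comm, (huB _ hb'').1, real_inner_comm, (huB _ hb).1])
  have hwu' := hw u' (by rw [real_inner_comm, (huB _ hb').2, real_inner_comm, (huB _ hb).2])
    (by rw [real_inner_comm, (huB _ hb'').2, real_inner_comm, (huB _ hb).2])
  have comm : ∀ x y : E 5, inner ℝ x y = 0 → inner ℝ y x = 0 := fun x y h => by
    rw [real_inner_comm]; exact h
  -- The five vectors exhaust `𝔼⁵`. Elements of `A` are orthogonal to `w`, `w'`, `e`, hence lie in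
  -- the plane of `u`, `u'` through the origin and not just in a parallel of it; likewise for `B`.
  -- This is what makes `c` vanish.
  obtain ⟨O, hO⟩ := exists_orthonormalBasis ![u, u', w, w', e]
    (orthonormal_of_inner huu huu' hww hww' he hu0 (comm _ _ hwu.1) (comm _ _ hwu.2) hue.1
      (comm _ _ hwu'.1) (comm _ _ hwu'.2) hue.2 hw0 hwe.1 hwe.2)
  have expand : ∀ z : E 5, z = inner ℝ u z • u + inner ℝ u' z • u' + inner ℝ w z • w
      + inner ℝ w' z • w' + inner ℝ e z • e := fun z => by
    conv_lhs => rw [← O.sum_repr' z]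
    simp [Fin.sum_univ_five, hO]
  have expA : ∀ z ∈ A, z = inner ℝ u z • u + inner ℝ u' z • u' := fun z hz => by
    conv_lhs => rw [expand z, (hwA z hz).1, (hwA z hz).2, comm _ _ (hAe z hz)]
    simp
  have expB : ∀ z ∈ B, z = inner ℝ w z • w + inner ℝ w' z • w' := fun z hz => by
    conv_lhs => rw [expand z, (huB z hz).1, (huB z hz).2, comm _ _ (hBe z hz)]
    simp
  refine ⟨?_, ?_⟩
  · rw [← hAB _ ha _ hb]
    conv_lhs => rw [expA _ ha]
    simp [inner_add_left, inner_smul_left, huB b hb]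
  obtain ⟨p, hp⟩ : ∃ p, p = inner ℝ u a₀ := ⟨_, rfl⟩
  obtain ⟨q, hq⟩ : ∃ q, q = inner ℝ u' a₀ := ⟨_, rfl⟩
  obtain ⟨p', hp'⟩ : ∃ p, p = inner ℝ w b₀ := ⟨_, rfl⟩
  obtain ⟨q', hq'⟩ : ∃ q, q = inner ℝ w' b₀ := ⟨_, rfl⟩
  have ea : a₀ = p • u + q • u' := by rw [hp, hq]; exact expA _ ha₀
  have eb : b₀ = p' • w + q' • w' := by rw [hp', hq']; exact expB _ hb₀
  have hpq : p ^ 2 + q ^ 2 = RA ^ 2 := by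
    rw [← hA _ ha₀, ea]
    simp only [inner_add_left, inner_add_right, inner_smul_left, inner_smul_right, huu, huu',
      hu0, comm _ _ hu0, conj_trivial]
    ring
  have hpq' : p' ^ 2 + q' ^ 2 = RB ^ 2 := by
    rw [← hB _ hb₀, eb]
    simp only [inner_add_left, inner_add_right, inner_smul_left, inner_smul_right, hww, hww',
      hw0, comm _ _ hw0, conj_trivial]
    ring
  -- Each plane's basis is rotated so that it starts with the normalized `a₀`, respectively `b₀`.
  obtain ⟨O', hO'⟩ := exists_orthonormalBasis
    ![RA⁻¹ • (p • u + q • u'), RA⁻¹ • ((-q) • u + p • u'),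
      RB⁻¹ • (p' • w + q' • w'), RB⁻¹ • ((-q') • w + p' • w'), e] (by
    have k1 := comm _ _ hu0
    have k2 := comm _ _ hw0
    have k3 := comm _ _ hwu.1
    have k4 := comm _ _ hwu.2
    have k5 := comm _ _ hwu'.1
    have k6 := comm _ _ hwu'.2
    apply orthonormal_of_inner <;>
      simp only [Matrix.cons_val, inner_add_left, inner_add_right, inner_smul_left,
        inner_smul_right, huu, huu', hww, hww', hu0, hw0, hue.1, hue.2, hwe.1, hwe.2, he, k1, k2,
        k3, k4, k5, k6, conj_trivial, mul_zero, mul_one, add_zero, zero_add]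
    · field_simp; linear_combination hpq
    · field_simp; linear_combination hpq
    · field_simp; linear_combination hpq'
    · field_simp; linear_combination hpq'
    · ring
    · ring)
  refine ⟨O', ?_, ?_, ?_, fun z hz => ?_, fun z hz => ?_⟩
  · rw [hO', ea]; rfl
  · rw [hO', eb]; rfl
  · rw [hO']; rfl
  · simp [hO', inner_add_left, inner_smul_left, hwA z hz]
  · simp [hO', inner_add_left, inner_smul_left, huB z hz]

end Planes

/-! ### Local product structure: two maps varying independently. -/

section Product

/-- A map is constant along a coordinate direction of a chart if its derivative vanishes on a
vector field proportional to that direction. -/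
theorem eq_of_chart_direction {ψ : OpenPartialHomeomorph (E 3) (Fin 3 → ℝ)}
    (hψs : ContDiffOn ℝ ∞ ψ ψ.source) (hψt : ContDiffOn ℝ ∞ ψ.symm ψ.target) {f : E 3 → E 5}
    (hf : ContDiffOn ℝ ∞ f ψ.source) {B : Set (Fin 3 → ℝ)} (hB : Convex ℝ B)
    (hBt : B ⊆ ψ.target) (i : Fin 3)
    (hd : ∀ w ∈ B, ∃ e : E 3, ∃ c : ℝ, c ≠ 0 ∧
      fderiv ℝ ψ (ψ.symm w) e = c • Pi.single i (1 : ℝ) ∧ fderiv ℝ f (ψ.symm w) e = 0)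
    {y y' : Fin 3 → ℝ} (hy : y ∈ B) (hy' : y' ∈ B) (hyy : ∀ j, j ≠ i → y j = y' j) :
    f (ψ.symm y) = f (ψ.symm y') := by
  have hseg : ∀ t ∈ Set.Icc (0 : ℝ) 1, y' + t • (y - y') ∈ B := fun t ht =>
    hB.add_smul_sub_mem hy' hy ht
  have hF : ContDiffOn ℝ ∞ (f ∘ ψ.symm) ψ.target := hf.comp hψt fun w hw => ψ.map_target hw
  have hFd : ∀ w ∈ ψ.target, DifferentiableAt ℝ (f ∘ ψ.symm) w := fun w hw =>
    (hF.contDiffAt (ψ.open_target.mem_nhds hw)).differentiableAt (by simp)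
  refine eq_of_fderiv_segment (f := f ∘ ψ.symm) (fun t ht => hFd _ (hBt (hseg t ht)))
    fun t ht => ?_
  set w := y' + t • (y - y')
  have hw : w ∈ ψ.target := hBt (hseg t ht)
  obtain ⟨e, c, hc, he, hfe⟩ := hd w (hseg t ht)
  have hz : ψ.symm w ∈ ψ.source := ψ.map_target hw
  have hdir : y - y' = ((y i - y' i) / c) • fderiv ℝ ψ (ψ.symm w) e := by
    rw [he, smul_smul, div_mul_cancel₀ _ hc]
    ext j
    by_cases hj : j = i
    · subst hj; simp
    · simp [hj, hyy j hj]
  have hψd : DifferentiableAt ℝ ψ (ψ.symm w) :=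
    (hψs.contDiffAt (ψ.open_source.mem_nhds hz)).differentiableAt (by simp)
  have hcomp : fderiv ℝ ((f ∘ ψ.symm) ∘ ψ) (ψ.symm w) = fderiv ℝ f (ψ.symm w) := by
    refine Filter.EventuallyEq.fderiv_eq ?_
    filter_upwards [ψ.open_source.mem_nhds hz] with z hz
    simp [ψ.left_inv hz]
  rw [fderiv_comp _ (by rw [ψ.right_inv hw]; exact hFd w hw) hψd, ψ.right_inv hw] at hcomp
  have := congrArg (fun L => L e) hcomp
  simp only [ContinuousLinearMap.comp_apply, hfe] at this
  rw [hdir, map_smul, this, smul_zero]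

set_option maxHeartbeats 800000 in
/-- Let `dV` and `dW` vanish on a line field transverse to the slices `h = const`, and let the
restrictions of `V` and `W` to one slice have rank one with complementary kernels. Then the values
of `V` and `W` near a point of that slice can be prescribed independently. -/
theorem exists_product_neighbourhood {O : Set (E 3)} (hO : IsOpen O) {V W : E 3 → E 5}
    {h : E 3 → ℝ} (hV : ContDiffOn ℝ ∞ V O) (hW : ContDiffOn ℝ ∞ W O) (hh : ContDiffOn ℝ ∞ h O)
    {q : E 3} (hq : q ∈ O)
    (h₁ : ∀ z ∈ O, ∃ e, fderiv ℝ h z e ≠ 0 ∧ fderiv ℝ V z e = 0 ∧ fderiv ℝ W z e = 0)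
    (h₂ : ∀ z ∈ O, h z = h q → ∃ e₂ e₃, fderiv ℝ h z e₂ = 0 ∧ fderiv ℝ h z e₃ = 0 ∧
      fderiv ℝ V z e₃ = 0 ∧ fderiv ℝ W z e₂ = 0 ∧ fderiv ℝ V z e₂ ≠ 0 ∧ fderiv ℝ W z e₃ ≠ 0) :
    ∃ O' : Set (E 3), IsOpen O' ∧ q ∈ O' ∧ O' ⊆ O ∧
      (∀ a ∈ O', ∀ b ∈ O', ∃ c ∈ O', V c = V a ∧ W c = W b) ∧
      (∃ a ∈ O', ∃ b ∈ O', ∃ c ∈ O', V a ≠ V b ∧ V a ≠ V c ∧ V b ≠ V c) ∧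
      (∃ a ∈ O', ∃ b ∈ O', ∃ c ∈ O', W a ≠ W b ∧ W a ≠ W c ∧ W b ≠ W c) := by
  obtain ⟨e₁, he₁, hVe₁, hWe₁⟩ := h₁ q hq
  obtain ⟨e₂, e₃, he₂, he₃, hVe₃, hWe₂, hVe₂, hWe₃⟩ := h₂ q hq rfl
  obtain ⟨i, hi⟩ : ∃ i, fderiv ℝ V q e₂ i ≠ 0 := by
    by_contra! hc
    exact hVe₂ (by ext i; simpa using hc i)
  obtain ⟨j, hj⟩ : ∃ j, fderiv ℝ W q e₃ j ≠ 0 := by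
    by_contra! hc
    exact hWe₃ (by ext i; simpa using hc i)
  -- Local coordinates: the height, and one component each of `V` and `W` that varies to first order
  -- at `q`.
  let f : E 3 → (Fin 3 → ℝ) := fun z => ![h z, V z i, W z j]
  have hd : ∀ z ∈ O, ∀ {n : ℕ} {g : E 3 → E n}, ContDiffOn ℝ ∞ g O → DifferentiableAt ℝ g z :=
    fun z hz _ g hg => (hg.contDiffAt (hO.mem_nhds hz)).differentiableAt (by simp)
  have hhd : ∀ z ∈ O, DifferentiableAt ℝ h z := fun z hz =>
    (hh.contDiffAt (hO.mem_nhds hz)).differentiableAt (by simp)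
  have hcoord : ∀ {g : E 3 → E 5} (z : E 3), DifferentiableAt ℝ g z → ∀ k : Fin 5,
      HasFDerivAt (fun z => g z k) ((EuclideanSpace.proj k).comp (fderiv ℝ g z)) z :=
    fun {g} z hg k => (EuclideanSpace.proj k : E 5 →L[ℝ] ℝ).hasFDerivAt.comp z hg.hasFDerivAt
  have hfs : ContDiffOn ℝ ∞ f O := by
    rw [contDiffOn_pi]
    intro k
    fin_cases k
    · exact hh
    · exact (EuclideanSpace.proj i : E 5 →L[ℝ] ℝ).contDiff.comp_contDiffOn hV
    · exact (EuclideanSpace.proj j : E 5 →L[ℝ] ℝ).contDiff.comp_contDiffOn hW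
  have hfd : ∀ z ∈ O, ∀ X, fderiv ℝ f z X =
      ![fderiv ℝ h z X, fderiv ℝ V z X i, fderiv ℝ W z X j] := by
    intro z hz X
    have : HasFDerivAt f (ContinuousLinearMap.pi ![fderiv ℝ h z,
        (EuclideanSpace.proj i).comp (fderiv ℝ V z),
        (EuclideanSpace.proj j).comp (fderiv ℝ W z)]) z := by
      rw [hasFDerivAt_pi]
      intro k
      fin_cases k
      · exact (hhd z hz).hasFDerivAt
      · exact hcoord z (hd z hz hV) i
      · exact hcoord z (hd z hz hW) j
    rw [this.fderiv]
    ext k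
    fin_cases k <;> simp
  have hsurj : Function.Surjective (fderiv ℝ f q) := by
    intro y
    refine ⟨(y 0 / fderiv ℝ h q e₁) • e₁ + (y 1 / fderiv ℝ V q e₂ i) • e₂ +
      (y 2 / fderiv ℝ W q e₃ j) • e₃, ?_⟩
    rw [hfd q hq]
    ext k
    fin_cases k <;> simp [he₂, he₃, hVe₁, hWe₁, hVe₃, hWe₂, he₁, hi, hj]
  have hinj : ∀ X, fderiv ℝ f q X = 0 → X = 0 := by
    have := (LinearMap.injective_iff_surjective_of_finrank_eq_finrank
      (f := (fderiv ℝ f q).toLinearMap) (by simp)).2 hsurj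
    exact (injective_iff_map_eq_zero (fderiv ℝ f q).toLinearMap).1 this
  obtain ⟨ψ, hqψ, hψO, hψ, hψs, hψt⟩ := exists_openPartialHomeomorph hO hfs hq (by simp) hinj
  have hψf : (ψ : E 3 → Fin 3 → ℝ) = f := funext hψ
  have hψinj : ∀ z ∈ ψ.source, ∀ X, fderiv ℝ f z X = 0 → X = 0 := by
    intro z hz X hX
    have h1 : fderiv ℝ (ψ.symm ∘ ψ) z = ContinuousLinearMap.id ℝ (E 3) := by
      rw [← fderiv_id (x := z)]
      refine Filter.EventuallyEq.fderiv_eq ?_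
      filter_upwards [ψ.open_source.mem_nhds hz] with z hz
      simp [ψ.left_inv hz]
    rw [fderiv_comp _ ((hψt.contDiffAt (ψ.open_target.mem_nhds
      (ψ.map_source hz))).differentiableAt (by simp)) ((hψs.contDiffAt
      (ψ.open_source.mem_nhds hz)).differentiableAt (by simp))] at h1
    have := congrArg (fun L => L X) h1
    simpa [hψf, hX] using this.symm
  obtain ⟨ε, hε, hball⟩ := Metric.isOpen_iff.1 ψ.open_target _ (ψ.map_source hqψ)
  have hmem : ∀ y : Fin 3 → ℝ, y ∈ Metric.ball (ψ q) ε ↔ |y 0 - h q| < ε ∧ |y 1 - V q i| < ε ∧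
      |y 2 - W q j| < ε := by
    intro y
    rw [Metric.mem_ball, dist_pi_lt_iff hε, Fin.forall_fin_succ, Fin.forall_fin_succ,
      Fin.forall_fin_succ]
    simp [hψ, f, Real.dist_eq]
  have hsymm0 : ∀ y ∈ ψ.target, h (ψ.symm y) = y 0 := fun y hy => by
    conv_rhs => rw [← ψ.right_inv hy, hψ]
    rfl
  have hsymm1 : ∀ y ∈ ψ.target, V (ψ.symm y) i = y 1 := fun y hy => by
    conv_rhs => rw [← ψ.right_inv hy, hψ]
    rfl
  have hsymm2 : ∀ y ∈ ψ.target, W (ψ.symm y) j = y 2 := fun y hy => by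
    conv_rhs => rw [← ψ.right_inv hy, hψ]
    rfl
  have hVs := hV.mono hψO
  have hWs := hW.mono hψO
  have hsrc : ∀ y ∈ Metric.ball (ψ q) ε, ψ.symm y ∈ ψ.source := fun y hy =>
    ψ.map_target (hball hy)
  -- the maps do not depend on the first coordinate
  have hdir0 : ∀ w ∈ Metric.ball (ψ q) ε, ∃ e : E 3, ∃ c : ℝ, c ≠ 0 ∧
      fderiv ℝ ψ (ψ.symm w) e = c • Pi.single 0 (1 : ℝ) ∧ fderiv ℝ V (ψ.symm w) e = 0 ∧
      fderiv ℝ W (ψ.symm w) e = 0 := by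
    intro w hw
    have hz := hψO (hsrc w hw)
    obtain ⟨e, he, hVe, hWe⟩ := h₁ _ hz
    refine ⟨e, _, he, ?_, hVe, hWe⟩
    rw [hψf, hfd _ hz]
    ext k
    fin_cases k <;> simp [hVe, hWe]
  -- on the slice they depend on one coordinate each
  have hslice : Convex ℝ (Metric.ball (ψ q) ε ∩ {w : Fin 3 → ℝ | w 0 = h q}) :=
    (convex_ball _ _).inter fun a ha b hb s t _ _ hst => by
      simp only [Set.mem_ofPred_eq] at ha hb ⊢
      simp [ha, hb, ← add_mul, hst]
  have hdir12 : ∀ w ∈ Metric.ball (ψ q) ε ∩ {w : Fin 3 → ℝ | w 0 = h q},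
      (∃ e : E 3, ∃ c : ℝ, c ≠ 0 ∧ fderiv ℝ ψ (ψ.symm w) e = c • Pi.single 2 (1 : ℝ) ∧
        fderiv ℝ V (ψ.symm w) e = 0) ∧
      (∃ e : E 3, ∃ c : ℝ, c ≠ 0 ∧ fderiv ℝ ψ (ψ.symm w) e = c • Pi.single 1 (1 : ℝ) ∧
        fderiv ℝ W (ψ.symm w) e = 0) := by
    rintro w ⟨hw, hw0⟩
    have hz := hψO (hsrc w hw)
    obtain ⟨a₂, a₃, ha₂, ha₃, hVa₃, hWa₂, hVa₂, hWa₃⟩ :=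
      h₂ _ hz ((hsymm0 w (hball hw)).trans hw0)
    constructor
    -- The coefficient is nonzero: otherwise the derivative of the coordinate map would kill `a₃`,
    -- forcing `a₃ = 0`.
    · refine ⟨a₃, fderiv ℝ W (ψ.symm w) a₃ j, fun h0 => hWa₃ ?_, ?_, hVa₃⟩
      · rw [hψinj _ (hsrc w hw) a₃ ?_, map_zero]
        rw [hfd _ hz, ha₃, hVa₃, h0]
        ext k
        fin_cases k <;> simp
      · rw [hψf, hfd _ hz]
        ext k
        fin_cases k <;> simp [ha₃, hVa₃]
    · refine ⟨a₂, fderiv ℝ V (ψ.symm w) a₂ i, fun h0 => hVa₂ ?_, ?_, hWa₂⟩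
      · rw [hψinj _ (hsrc w hw) a₂ ?_, map_zero]
        rw [hfd _ hz, ha₂, hWa₂, h0]
        ext k
        fin_cases k <;> simp
      · rw [hψf, hfd _ hz]
        ext k
        fin_cases k <;> simp [ha₂, hWa₂]
  -- `h₂` is available only at the height of `q`. So one moves first along coordinate `0` to that
  -- slice, then inside it.
  have hVdep : ∀ y ∈ Metric.ball (ψ q) ε, ∀ y' ∈ Metric.ball (ψ q) ε, y 1 = y' 1 →
      V (ψ.symm y) = V (ψ.symm ![h q, y' 1, y' 2]) := by
    intro y hy y' hy' hyy
    rw [hmem] at hy hy'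
    have m1 : ![h q, y 1, y 2] ∈ Metric.ball (ψ q) ε := by rw [hmem]; simp [hε, hy.2.1, hy.2.2]
    have m2 : ![h q, y' 1, y' 2] ∈ Metric.ball (ψ q) ε := by rw [hmem]; simp [hε, hy'.2.1, hy'.2.2]
    rw [eq_of_chart_direction hψs hψt hVs (convex_ball _ _) hball 0
      (fun w hw => (hdir0 w hw).imp fun e ⟨c, k1, k2, k3, _⟩ => ⟨c, k1, k2, k3⟩)
      ((hmem y).2 hy) m1 (by intro k hk; fin_cases k; exacts [absurd rfl hk, rfl, rfl])]
    exact eq_of_chart_direction hψs hψt hVs hslice (fun w hw => hball hw.1) 2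
      (fun w hw => (hdir12 w hw).1) ⟨m1, rfl⟩ ⟨m2, rfl⟩
      (by intro k hk; fin_cases k; exacts [rfl, hyy, absurd rfl hk])
  have hWdep : ∀ y ∈ Metric.ball (ψ q) ε, ∀ y' ∈ Metric.ball (ψ q) ε, y 2 = y' 2 →
      W (ψ.symm y) = W (ψ.symm ![h q, y' 1, y' 2]) := by
    intro y hy y' hy' hyy
    rw [hmem] at hy hy'
    have m1 : ![h q, y 1, y 2] ∈ Metric.ball (ψ q) ε := by rw [hmem]; simp [hε, hy.2.1, hy.2.2]
    have m2 : ![h q, y' 1, y' 2] ∈ Metric.ball (ψ q) ε := by rw [hmem]; simp [hε, hy'.2.1, hy'.2.2]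
    rw [eq_of_chart_direction hψs hψt hWs (convex_ball _ _) hball 0
      (fun w hw => (hdir0 w hw).imp fun e ⟨c, k1, k2, _, k3⟩ => ⟨c, k1, k2, k3⟩)
      ((hmem y).2 hy) m1 (by intro k hk; fin_cases k; exacts [absurd rfl hk, rfl, rfl])]
    exact eq_of_chart_direction hψs hψt hWs hslice (fun w hw => hball hw.1) 1
      (fun w hw => (hdir12 w hw).2) ⟨m1, rfl⟩ ⟨m2, rfl⟩
      (by intro k hk; fin_cases k; exacts [rfl, absurd rfl hk, hyy])
  have hO'mem : ∀ y ∈ Metric.ball (ψ q) ε, ψ.symm y ∈ ψ.source ∩ ψ ⁻¹' Metric.ball (ψ q) ε :=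
    fun y hy => ⟨hsrc y hy, by rw [Set.mem_preimage, ψ.right_inv (hball hy)]; exact hy⟩
  refine ⟨ψ.source ∩ ψ ⁻¹' Metric.ball (ψ q) ε, ψ.isOpen_inter_preimage Metric.isOpen_ball,
    ⟨hqψ, Metric.mem_ball_self hε⟩, fun z hz => hψO hz.1, ?_, ?_, ?_⟩
  · rintro a ⟨ha, ha'⟩ b ⟨hb, hb'⟩
    -- The point with the height of `q`, the `V`-coordinate of `a` and the `W`-coordinate of `b`.
    have hc : ![h q, ψ a 1, ψ b 2] ∈ Metric.ball (ψ q) ε := by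
      have k1 := (hmem _).1 ha'
      have k2 := (hmem _).1 hb'
      rw [hmem]; simp [hε, k1.2.1, k2.2.2]
    refine ⟨ψ.symm ![h q, ψ a 1, ψ b 2], hO'mem _ hc, ?_, ?_⟩
    · have := hVdep _ ha' _ hc rfl
      rw [ψ.left_inv ha] at this
      exact this.symm
    · have := hWdep _ hb' _ hc rfl
      rw [ψ.left_inv hb] at this
      exact this.symm
  all_goals
    have hp : ∀ s t : ℝ, |s| < ε → |t| < ε →
        ![h q, V q i + s, W q j + t] ∈ Metric.ball (ψ q) ε := fun s t hs ht => by
      rw [hmem]; simp [hε, hs, ht]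
    have m0 : |(0 : ℝ)| < ε := by simpa using hε
    have m1 : |ε / 2| < ε := by rw [abs_of_pos (by linarith)]; linarith
    have m2 : |ε / 3| < ε := by rw [abs_of_pos (by linarith)]; linarith
  · refine ⟨_, hO'mem _ (hp 0 0 m0 m0), _, hO'mem _ (hp (ε / 2) 0 m1 m0), _,
      hO'mem _ (hp (ε / 3) 0 m2 m0), fun he => ?_, fun he => ?_, fun he => ?_⟩
    all_goals
      have := congrArg (fun v : E 5 => v i) he
      simp only [hsymm1 _ (hball (hp _ _ m0 m0)), hsymm1 _ (hball (hp _ _ m1 m0)),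
        hsymm1 _ (hball (hp _ _ m2 m0))] at this
      simp at this
      linarith
  · refine ⟨_, hO'mem _ (hp 0 0 m0 m0), _, hO'mem _ (hp 0 (ε / 2) m0 m1), _,
      hO'mem _ (hp 0 (ε / 3) m0 m2), fun he => ?_, fun he => ?_, fun he => ?_⟩
    all_goals
      have := congrArg (fun v : E 5 => v j) he
      simp only [hsymm2 _ (hball (hp _ _ m0 m0)), hsymm2 _ (hball (hp _ _ m0 m1)),
        hsymm2 _ (hball (hp _ _ m0 m2))] at this
      simp at this
      linarith

end Product

/-! ### Transport of the slices along `T`, and their focal maps. -/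

section Twist

/-- At the point `z`, the basis `e₁, e₂, e₃` consists of the vector field `T` and two further
principal directions of a hypersurface of `𝕊³ × ℝ`. Here `P` and `Q` are the components of the
position and of the unit normal orthogonal to `∂/∂t`, `h` and `σ` their last coordinates. -/
structure IsPrincipalFrame (P Q : E 3 → E 5) (h σ : E 3 → ℝ) (k₁ k₂ k₃ : ℝ) (z e₁ e₂ e₃ : E 3) :
    Prop where
  span : ∀ X, ∃ a b c : ℝ, X = a • e₁ + b • e₂ + c • e₃
  height₁ : fderiv ℝ h z e₁ = 1 - σ z ^ 2
  height₂ : fderiv ℝ h z e₂ = 0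
  height₃ : fderiv ℝ h z e₃ = 0
  angle₁ : fderiv ℝ σ z e₁ = -k₁ * (1 - σ z ^ 2)
  angle₂ : fderiv ℝ σ z e₂ = 0
  angle₃ : fderiv ℝ σ z e₃ = 0
  position₁ : fderiv ℝ P z e₁ = -σ z • Q z
  position₂ : fderiv ℝ P z e₂ ≠ 0
  position₃ : fderiv ℝ P z e₃ ≠ 0
  normal₁ : fderiv ℝ Q z e₁ = (k₁ * σ z) • Q z + (σ z * (1 - σ z ^ 2)) • P z
  normal₂ : fderiv ℝ Q z e₂ = -k₂ • fderiv ℝ P z e₂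
  normal₃ : fderiv ℝ Q z e₃ = -k₃ • fderiv ℝ P z e₃

/-- A hypersurface of `𝕊³ × ℝ` parametrized by an open set of `𝔼³`, with principal curvatures
`k₁, k₂, k₃` and principal direction `T`. -/
structure IsPrincipalPatch (U : Set (E 3)) (P Q : E 3 → E 5) (h σ k₁ k₂ k₃ : E 3 → ℝ) : Prop where
  isOpen : IsOpen U
  smooth_P : ContDiffOn ℝ ∞ P U
  smooth_Q : ContDiffOn ℝ ∞ Q U
  smooth_h : ContDiffOn ℝ ∞ h U
  smooth_σ : ContDiffOn ℝ ∞ σ U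
  inner_P : ∀ z ∈ U, inner ℝ (P z) (P z) = 1
  inner_Q : ∀ z ∈ U, inner ℝ (Q z) (Q z) = 1 - σ z ^ 2
  inner_PQ : ∀ z ∈ U, inner ℝ (P z) (Q z) = 0
  P_dt : ∀ z ∈ U, inner ℝ (P z) dt = 0
  Q_dt : ∀ z ∈ U, inner ℝ (Q z) dt = 0
  σ_lt : ∀ z ∈ U, σ z ^ 2 < 1
  frame : ∀ z ∈ U, ∃ e₁ e₂ e₃, IsPrincipalFrame P Q h σ (k₁ z) (k₂ z) (k₃ z) z e₁ e₂ e₃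

variable {U : Set (E 3)} {P Q : E 3 → E 5} {h σ k₁ k₂ k₃ : E 3 → ℝ}

theorem IsPrincipalPatch.mono (hp : IsPrincipalPatch U P Q h σ k₁ k₂ k₃) {O : Set (E 3)}
    (hO : IsOpen O) (hOU : O ⊆ U) : IsPrincipalPatch O P Q h σ k₁ k₂ k₃ where
  isOpen := hO
  smooth_P := hp.smooth_P.mono hOU
  smooth_Q := hp.smooth_Q.mono hOU
  smooth_h := hp.smooth_h.mono hOU
  smooth_σ := hp.smooth_σ.mono hOU
  inner_P z hz := hp.inner_P z (hOU hz)
  inner_Q z hz := hp.inner_Q z (hOU hz)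
  inner_PQ z hz := hp.inner_PQ z (hOU hz)
  P_dt z hz := hp.P_dt z (hOU hz)
  Q_dt z hz := hp.Q_dt z (hOU hz)
  σ_lt z hz := hp.σ_lt z (hOU hz)
  frame z hz := hp.frame z (hOU hz)

/-- Allows the assumption `k₃ < k₂`. -/
theorem IsPrincipalPatch.swap (hp : IsPrincipalPatch U P Q h σ k₁ k₂ k₃) :
    IsPrincipalPatch U P Q h σ k₁ k₃ k₂ where
  __ := hp
  frame z hz := by
    obtain ⟨e₁, e₂, e₃, he⟩ := hp.frame z hz
    refine ⟨e₁, e₃, e₂, ?_, he.height₁, he.height₃, he.height₂, he.angle₁, he.angle₃, he.angle₂,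
      he.position₁, he.position₃, he.position₂, he.normal₁, he.normal₃, he.normal₂⟩
    intro X
    obtain ⟨a, b, c, rfl⟩ := he.span X
    exact ⟨a, c, b, by abel⟩

/-- The functions of the height attached to the angle function `σ = F ∘ h`: `r = (1 - F²)^(-1/2)`,
and primitives `β` of `F r` and `S` of `r`. -/
structure IsHeightProfile (t₀ ε : ℝ) (F r β S : ℝ → ℝ) : Prop where
  pos : 0 < ε
  smooth_F : ContDiffOn ℝ ∞ F (Metric.ball t₀ ε)
  smooth_r : ContDiffOn ℝ ∞ r (Metric.ball t₀ ε)
  smooth_β : ContDiffOn ℝ ∞ β (Metric.ball t₀ ε)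
  smooth_S : ContDiffOn ℝ ∞ S (Metric.ball t₀ ε)
  r_pos : ∀ t ∈ Metric.ball t₀ ε, 0 < r t
  r_sq : ∀ t ∈ Metric.ball t₀ ε, r t ^ 2 * (1 - F t ^ 2) = 1
  deriv_r : ∀ t ∈ Metric.ball t₀ ε, HasDerivAt r (F t * deriv F t * r t ^ 3) t
  deriv_β : ∀ t ∈ Metric.ball t₀ ε, HasDerivAt β (F t * r t) t
  deriv_S : ∀ t ∈ Metric.ball t₀ ε, HasDerivAt S (r t) t
  β_zero : β t₀ = 0

theorem exists_isHeightProfile {t₀ ε₀ : ℝ} (hε₀ : 0 < ε₀) {F : ℝ → ℝ}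
    (hF : ContDiffOn ℝ ∞ F (Metric.ball t₀ ε₀)) (hF₀ : F t₀ ^ 2 < 1) :
    ∃ ε r β S, IsHeightProfile t₀ ε F r β S := by
  have hc : ContinuousAt (fun t => F t ^ 2) t₀ :=
    (hF.continuousOn.continuousAt (Metric.ball_mem_nhds t₀ hε₀)).pow 2
  obtain ⟨ε, hε, hεs⟩ := Metric.eventually_nhds_iff_ball.1
    ((hc.eventually_lt continuousAt_const hF₀).and (Metric.ball_mem_nhds t₀ hε₀))
  have hFε : ContDiffOn ℝ ∞ F (Metric.ball t₀ ε) := hF.mono fun t ht => (hεs t ht).2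
  have hpos : ∀ t ∈ Metric.ball t₀ ε, 0 < 1 - F t ^ 2 := fun t ht => by
    linarith [(hεs t ht).1]
  have hr : ContDiffOn ℝ ∞ (fun t => (Real.sqrt (1 - F t ^ 2))⁻¹) (Metric.ball t₀ ε) := by
    refine ContDiffOn.inv ?_ fun t ht => (Real.sqrt_pos.2 (hpos t ht)).ne'
    exact (contDiffOn_const.sub (hFε.pow 2)).sqrt fun t ht => (hpos t ht).ne'
  obtain ⟨β, hβ0, hβs, hβ⟩ := exists_primitive (hFε.mul hr)
  obtain ⟨S, -, hSs, hS⟩ := exists_primitive hr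
  refine ⟨ε, _, β, S, hε, hFε, hr, hβs, hSs, fun t ht => inv_pos.2 (Real.sqrt_pos.2 (hpos t ht)),
    fun t ht => ?_, fun t ht => ?_, hβ, hS, hβ0⟩
  · rw [inv_pow, Real.sq_sqrt (hpos t ht).le, inv_mul_cancel₀ (hpos t ht).ne']
  · have hFd : HasDerivAt F (deriv F t) t :=
      ((hFε.contDiffAt (Metric.isOpen_ball.mem_nhds ht)).differentiableAt (by simp)).hasDerivAt
    have h1 := ((((hFd.pow 2).const_sub 1).sqrt (hpos t ht).ne').inv
      (Real.sqrt_pos.2 (hpos t ht)).ne')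
    refine h1.congr_deriv ?_
    have := (Real.sqrt_pos.2 (hpos t ht)).ne'
    simp
    field_simp

/-- The angle function of a principal patch is locally a function of the height. -/
theorem IsPrincipalPatch.exists_profile (hp : IsPrincipalPatch U P Q h σ k₁ k₂ k₃) {q : E 3}
    (hq : q ∈ U) : ∃ (ε : ℝ) (F r β S : ℝ → ℝ) (O : Set (E 3)), IsHeightProfile (h q) ε F r β S ∧
      IsOpen O ∧ q ∈ O ∧ O ⊆ U ∧ ∀ z ∈ O, h z ∈ Metric.ball (h q) ε ∧ σ z = F (h z) := by
  obtain ⟨e₁, e₂, e₃, he⟩ := hp.frame q hq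
  have hne : fderiv ℝ h q ≠ 0 := fun h0 => by
    have h1 := he.height₁
    rw [h0] at h1
    have := hp.σ_lt q hq
    simp at h1
    linarith
  -- The kernel of `dh` is spanned by `e₂` and `e₃`, and `dσ` vanishes on both.
  obtain ⟨ε₀, F, hε₀, hF, hev⟩ := exists_factor hp.isOpen hp.smooth_σ hp.smooth_h hq hne (by
    intro z hz X hX
    obtain ⟨e₁, e₂, e₃, he⟩ := hp.frame z hz
    obtain ⟨a, b, c, rfl⟩ := he.span X
    have h1 : 1 - σ z ^ 2 ≠ 0 := by linarith [hp.σ_lt z hz]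
    simp [he.height₁, he.height₂, he.height₃, h1] at hX
    simp [he.angle₂, he.angle₃, hX])
  have hFq : F (h q) ^ 2 < 1 := by
    rw [← hev.self_of_nhds.2]; exact hp.σ_lt q hq
  obtain ⟨ε, r, β, S, hpr⟩ := exists_isHeightProfile hε₀ hF hFq
  have hhc : ContinuousAt h q := hp.smooth_h.continuousOn.continuousAt (hp.isOpen.mem_nhds hq)
  obtain ⟨O, hO, hOo, hqO⟩ := eventually_nhds_iff.1
    ((hev.and (hhc (Metric.ball_mem_nhds _ hpr.pos))).and (hp.isOpen.mem_nhds hq))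
  exact ⟨ε, F, r, β, S, O, hpr, hOo, hqO, fun z hz => (hO z hz).2, fun z hz =>
    ⟨(hO z hz).1.2, (hO z hz).1.1.2⟩⟩

/-- A combination of the position and the unit normal of the slices `h = const` in `𝕊³` which is
constant along the integral curves of `T`. -/
noncomputable def twist (P Q : E 3 → E 5) (h : E 3 → ℝ) (r β : ℝ → ℝ) (l : ℝ) (z : E 3) : E 5 :=
  (-Real.sin (β (h z)) + l * Real.cos (β (h z))) • P z +
    ((Real.cos (β (h z)) + l * Real.sin (β (h z))) * r (h z)) • Q z

variable {O : Set (E 3)} {t₀ ε : ℝ} {F r β S : ℝ → ℝ}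

theorem contDiffOn_twist (hp : IsPrincipalPatch O P Q h σ k₁ k₂ k₃)
    (hpr : IsHeightProfile t₀ ε F r β S) (hO : ∀ z ∈ O, h z ∈ Metric.ball t₀ ε) (l : ℝ) :
    ContDiffOn ℝ ∞ (twist P Q h r β l) O := by
  have hβ : ContDiffOn ℝ ∞ (fun z => β (h z)) O := hpr.smooth_β.comp hp.smooth_h hO
  have hr : ContDiffOn ℝ ∞ (fun z => r (h z)) O := hpr.smooth_r.comp hp.smooth_h hO
  have hs := Real.contDiff_sin.comp_contDiffOn hβ
  have hc := Real.contDiff_cos.comp_contDiffOn hβ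
  exact ((hs.neg.add (contDiffOn_const.mul hc)).smul hp.smooth_P).add
    (((hc.add (contDiffOn_const.mul hs)).mul hr).smul hp.smooth_Q)

theorem fderiv_twist (hp : IsPrincipalPatch O P Q h σ k₁ k₂ k₃)
    (hpr : IsHeightProfile t₀ ε F r β S) (hO : ∀ z ∈ O, h z ∈ Metric.ball t₀ ε) (l : ℝ)
    {z : E 3} (hz : z ∈ O) (X : E 3) :
    fderiv ℝ (twist P Q h r β l) z X =
      (-(F (h z) * r (h z)) * (Real.cos (β (h z)) + l * Real.sin (β (h z))) *
        fderiv ℝ h z X) • P z +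
      (-Real.sin (β (h z)) + l * Real.cos (β (h z))) • fderiv ℝ P z X +
      ((F (h z) * r (h z) ^ 2 * (-Real.sin (β (h z)) + l * Real.cos (β (h z))) +
        F (h z) * deriv F (h z) * r (h z) ^ 3 *
          (Real.cos (β (h z)) + l * Real.sin (β (h z)))) * fderiv ℝ h z X) • Q z +
      ((Real.cos (β (h z)) + l * Real.sin (β (h z))) * r (h z)) • fderiv ℝ Q z X := by
  have hn := hp.isOpen.mem_nhds hz
  have hP := ((hp.smooth_P.contDiffAt hn).differentiableAt (by simp)).hasFDerivAt
  have hQ := ((hp.smooth_Q.contDiffAt hn).differentiableAt (by simp)).hasFDerivAt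
  have hh := ((hp.smooth_h.contDiffAt hn).differentiableAt (by simp)).hasFDerivAt
  have hβ := hpr.deriv_β _ (hO z hz)
  have hr := hpr.deriv_r _ (hO z hz)
  have ha : HasDerivAt (fun t => -Real.sin (β t) + l * Real.cos (β t))
      (-(F (h z) * r (h z)) * (Real.cos (β (h z)) + l * Real.sin (β (h z)))) (h z) := by
    refine (hβ.sin.neg.add (hβ.cos.const_mul l)).congr_deriv ?_
    ring
  have hb : HasDerivAt (fun t => (Real.cos (β t) + l * Real.sin (β t)) * r t)
      (F (h z) * r (h z) ^ 2 * (-Real.sin (β (h z)) + l * Real.cos (β (h z))) +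
        F (h z) * deriv F (h z) * r (h z) ^ 3 *
          (Real.cos (β (h z)) + l * Real.sin (β (h z)))) (h z) := by
    refine ((hβ.cos.add (hβ.sin.const_mul l)).mul hr).congr_deriv ?_
    simp only [Pi.add_apply]
    ring
  have := ((ha.comp_hasFDerivAt z hh).smul hP).add ((hb.comp_hasFDerivAt z hh).smul hQ)
  have h2 : fderiv ℝ (twist P Q h r β l) z = _ := this.fderiv
  rw [h2]
  simp
  abel

/-- `twist` with parameter `l` is `l p + n`, where `p = cos β P + sin β rQ` and `n = -sin β P + cos
β rQ` are orthonormal. -/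
theorem inner_twist (hp : IsPrincipalPatch O P Q h σ k₁ k₂ k₃)
    (hpr : IsHeightProfile t₀ ε F r β S)
    (hO : ∀ z ∈ O, h z ∈ Metric.ball t₀ ε ∧ σ z = F (h z)) (l m : ℝ) {z : E 3} (hz : z ∈ O) :
    inner ℝ (twist P Q h r β l z) (twist P Q h r β m z) = 1 + l * m := by
  have h1 := hpr.r_sq _ (hO z hz).1
  have h2 := hp.inner_Q z hz
  rw [(hO z hz).2] at h2
  have h3 := hp.inner_PQ z hz
  have h4 : inner ℝ (Q z) (P z) = 0 := by rw [real_inner_comm]; exact h3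
  simp only [twist, inner_add_left, inner_add_right, inner_smul_left, inner_smul_right, h2, h3, h4,
    hp.inner_P z hz, conj_trivial]
  linear_combination (Real.cos (β (h z)) + l * Real.sin (β (h z))) *
    (Real.cos (β (h z)) + m * Real.sin (β (h z))) * h1 +
    (1 + l * m) * Real.sin_sq_add_cos_sq (β (h z))

theorem inner_twist_dt (hp : IsPrincipalPatch O P Q h σ k₁ k₂ k₃) (l : ℝ) {z : E 3} (hz : z ∈ O) :
    inner ℝ (twist P Q h r β l z) dt = 0 := by
  simp only [twist, inner_add_left, inner_smul_left, hp.P_dt z hz, hp.Q_dt z hz, mul_zero, add_zero]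

/-- The first principal curvature is a function of the height. -/
theorem IsPrincipalPatch.curvature_eq (hp : IsPrincipalPatch O P Q h σ k₁ k₂ k₃)
    (hpr : IsHeightProfile t₀ ε F r β S)
    (hO : ∀ z ∈ O, h z ∈ Metric.ball t₀ ε ∧ σ z = F (h z)) {z : E 3} (hz : z ∈ O) :
    k₁ z = -deriv F (h z) := by
  have hn := hp.isOpen.mem_nhds hz
  obtain ⟨e₁, e₂, e₃, he⟩ := hp.frame z hz
  have hh := ((hp.smooth_h.contDiffAt hn).differentiableAt (by simp)).hasFDerivAt
  have hF := ((hpr.smooth_F.contDiffAt (Metric.isOpen_ball.mem_nhds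
    (hO z hz).1)).differentiableAt (by simp)).hasDerivAt
  have hσ : fderiv ℝ σ z = deriv F (h z) • fderiv ℝ h z := by
    rw [← (hF.comp_hasFDerivAt z hh).fderiv]
    refine Filter.EventuallyEq.fderiv_eq ?_
    filter_upwards [hn] with w hw using (hO w hw).2
  have h1 := he.angle₁
  rw [hσ] at h1
  simp only [smul_apply, he.height₁, smul_eq_mul] at h1
  have h2 : 1 - σ z ^ 2 ≠ 0 := by linarith [hp.σ_lt z hz]
  have := mul_right_cancel₀ h2 h1
  linarith

/-- With `β' = F r`, the frame formulas along `e₁` read `dP/dβ = -rQ` and `d(rQ)/dβ = P`: a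
rotation, which the sines and cosines in `twist` undo. -/
theorem fderiv_twist_height (hp : IsPrincipalPatch O P Q h σ k₁ k₂ k₃)
    (hpr : IsHeightProfile t₀ ε F r β S)
    (hO : ∀ z ∈ O, h z ∈ Metric.ball t₀ ε ∧ σ z = F (h z)) (l : ℝ) {z : E 3} (hz : z ∈ O)
    {e₁ e₂ e₃ : E 3} (he : IsPrincipalFrame P Q h σ (k₁ z) (k₂ z) (k₃ z) z e₁ e₂ e₃) :
    fderiv ℝ (twist P Q h r β l) z e₁ = 0 := by
  rw [fderiv_twist hp hpr (fun z hz => (hO z hz).1) l hz, he.height₁, he.position₁, he.normal₁,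
    hp.curvature_eq hpr hO hz, (hO z hz).2]
  have h1 := hpr.r_sq _ (hO z hz).1
  set b := Real.cos (β (h z)) + l * Real.sin (β (h z))
  set a := -Real.sin (β (h z)) + l * Real.cos (β (h z))
  have h2 : F (h z) * r (h z) ^ 2 * a * (1 - F (h z) ^ 2) = F (h z) * a := by
    linear_combination F (h z) * a * h1
  have h3 : F (h z) * deriv F (h z) * r (h z) ^ 3 * b * (1 - F (h z) ^ 2) =
      F (h z) * deriv F (h z) * r (h z) * b := by
    linear_combination F (h z) * deriv F (h z) * r (h z) * b * h1
  rw [add_mul, h2, h3]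
  module

/-- Since `β t₀ = 0`, the twist is `l P + rQ` on this slice. The choice `l = r k` kills the
direction `e`: up to scale it is the focal map for the curvature `r k`. -/
theorem fderiv_twist_slice (hp : IsPrincipalPatch O P Q h σ k₁ k₂ k₃)
    (hpr : IsHeightProfile t₀ ε F r β S) (hO : ∀ z ∈ O, h z ∈ Metric.ball t₀ ε) (l : ℝ) {z : E 3}
    (hz : z ∈ O) (hz₀ : h z = t₀) {k : ℝ} {e : E 3} (hhe : fderiv ℝ h z e = 0)
    (hQe : fderiv ℝ Q z e = -k • fderiv ℝ P z e) :
    fderiv ℝ (twist P Q h r β l) z e = (l - r t₀ * k) • fderiv ℝ P z e := by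
  rw [fderiv_twist hp hpr hO l hz, hhe, hQe, hz₀, hpr.β_zero]
  simp
  module

end Twist

/-! ### The two orthogonal planes and the angle between position and focal circles. -/

section Torus

variable {U O : Set (E 3)} {P Q : E 3 → E 5} {h σ k₁ k₂ k₃ : E 3 → ℝ}

theorem inner_dt_right (y : E 5) : inner ℝ y dt = y 4 := by
  simp [dt, PiLp.inner_apply, Fin.sum_univ_five]

theorem inner_dt_self : inner ℝ dt dt = (1 : ℝ) := by
  rw [inner_dt_right]
  simp [dt]

/-- Expresses `product` by the norm and the `dt`-component alone, which the coordinates of an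
orthonormal basis ending in `dt` preserve. -/
theorem mem_product_iff (y : E 5) : y ∈ product ↔ ‖y‖ ^ 2 = 1 + (inner ℝ y dt) ^ 2 := by
  rw [inner_dt_right, EuclideanSpace.norm_sq_eq, Fin.sum_univ_five]
  simp only [product, Set.mem_ofPred_eq, Real.norm_eq_abs, sq_abs]
  constructor <;> intro h <;> linarith

theorem image_product_of_basis (b : OrthonormalBasis (Fin 5) ℝ (E 5)) (hb : b 4 = dt) :
    b.repr.toAffineIsometryEquiv '' product = product := by
  have key : ∀ y, b.repr y ∈ product ↔ y ∈ product := by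
    intro y
    rw [mem_product_iff, mem_product_iff, b.repr.norm_map, inner_dt_right, b.repr_apply_apply, hb,
      real_inner_comm]
  ext y
  constructor
  · rintro ⟨x, hx, rfl⟩
    exact (key x).2 hx
  · intro hy
    exact ⟨b.repr.symm y, (key _).1 (by simpa using hy), by simp⟩

theorem sum_sq_inner (b : OrthonormalBasis (Fin 5) ℝ (E 5)) (v : E 5) :
    inner ℝ (b 0) v ^ 2 + inner ℝ (b 1) v ^ 2 + inner ℝ (b 2) v ^ 2 + inner ℝ (b 3) v ^ 2 +
      inner ℝ (b 4) v ^ 2 = inner ℝ v v := by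
  rw [real_inner_self_eq_norm_sq, ← b.sum_sq_norm_inner_right v, Fin.sum_univ_five]
  simp

theorem contDiffOn_inner_left {V : E 3 → E 5} (hV : ContDiffOn ℝ ∞ V O) (u : E 5) :
    ContDiffOn ℝ ∞ (fun z => inner ℝ u (V z)) O :=
  (innerSL ℝ u).contDiff.comp_contDiffOn hV

theorem hasFDerivAt_inner_left (hO : IsOpen O) {V : E 3 → E 5} (hV : ContDiffOn ℝ ∞ V O) (u : E 5)
    {z : E 3} (hz : z ∈ O) :
    HasFDerivAt (fun z => inner ℝ u (V z)) ((innerSL ℝ u).comp (fderiv ℝ V z)) z :=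
  (innerSL ℝ u).hasFDerivAt.comp z
    ((hV.contDiffAt (hO.mem_nhds hz)).differentiableAt (by simp)).hasFDerivAt

theorem inner_fderiv_eq_zero (hO : IsOpen O) {V : E 3 → E 5} (hV : ContDiffOn ℝ ∞ V O) {u : E 5}
    {c : ℝ} (hu : ∀ z ∈ O, inner ℝ u (V z) = c) {z : E 3} (hz : z ∈ O) (X : E 3) :
    inner ℝ u (fderiv ℝ V z X) = 0 := by
  have h1 := (hasFDerivAt_inner_left hO hV u hz).fderiv
  have h2 : fderiv ℝ (fun z => inner ℝ u (V z)) z = 0 := by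
    rw [← fderiv_const_apply (x := z) c]
    refine Filter.EventuallyEq.fderiv_eq ?_
    filter_upwards [hO.mem_nhds hz] with w hw using hu w hw
  rw [h2] at h1
  exact (congrArg (fun L => L X) h1).symm

theorem inner_fderiv_self_eq_zero (hO : IsOpen O) {V : E 3 → E 5} (hV : ContDiffOn ℝ ∞ V O)
    {c : ℝ} (hc : ∀ z ∈ O, inner ℝ (V z) (V z) = c) {z : E 3} (hz : z ∈ O) (X : E 3) :
    inner ℝ (V z) (fderiv ℝ V z X) = 0 := by
  have hd := ((hV.contDiffAt (hO.mem_nhds hz)).differentiableAt (by simp)).hasFDerivAt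
  have h1 := (hd.inner ℝ hd).fderiv
  have h2 : fderiv ℝ (fun z => inner ℝ (V z) (V z)) z = 0 := by
    rw [← fderiv_const_apply (x := z) c]
    refine Filter.EventuallyEq.fderiv_eq ?_
    filter_upwards [hO.mem_nhds hz] with w hw using hc w hw
  rw [h2] at h1
  have := congrArg (fun L => L X) h1
  simp [fderivInnerCLM_apply] at this
  rw [real_inner_comm (V z)] at this
  linarith

theorem sin_cos_arcsin {a b : ℝ} (ha : 0 < a) (hab : a ^ 2 + b ^ 2 = 1) :
    Real.cos (Real.arcsin b) = a ∧ Real.sin (Real.arcsin b) = b ∧ b ≠ -1 ∧ b ≠ 1 := by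
  have h1 : b ^ 2 < 1 := by nlinarith
  have h2 := abs_lt.1 ((sq_lt_one_iff_abs_lt_one b).1 h1)
  refine ⟨?_, Real.sin_arcsin h2.1.le h2.2.le, h2.1.ne', h2.2.ne⟩
  rw [Real.cos_arcsin, show 1 - b ^ 2 = a ^ 2 by linarith, Real.sqrt_sq ha.le]

/-- A principal patch whose principal curvatures depend on the first one only consists, locally, of
tori around two orthogonal planes: there are a basis adapted to these planes and an angle
function `θ` such that the position is
`cos θ` times a unit vector of the first plane plus `sin θ` times one of the second. -/
theorem IsPrincipalPatch.exists_planes (hp : IsPrincipalPatch U P Q h σ k₁ k₂ k₃)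
    {f₁ f₂ : ℝ → ℝ} (hf₁ : ∀ z ∈ U, k₂ z = f₁ (k₁ z)) (hf₂ : ∀ z ∈ U, k₃ z = f₂ (k₁ z))
    {q : E 3} (hq : q ∈ U) (hlt : k₃ q < k₂ q) :
    ∃ (ε : ℝ) (F r β S : ℝ → ℝ) (O : Set (E 3)) (V W : E 3 → E 5) (θ : ℝ)
      (b : OrthonormalBasis (Fin 5) ℝ (E 5)),
      IsHeightProfile (h q) ε F r β S ∧ IsOpen O ∧ q ∈ O ∧ O ⊆ U ∧
      (∀ z ∈ O, h z ∈ Metric.ball (h q) ε) ∧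
      0 < θ ∧ θ < Real.pi / 2 ∧
      ContDiffOn ℝ ∞ V O ∧ ContDiffOn ℝ ∞ W O ∧ b 0 = V q ∧ b 2 = W q ∧ b 4 = dt ∧
      (∀ z ∈ O, inner ℝ (V z) (V z) = 1 ∧ inner ℝ (W z) (W z) = 1) ∧
      (∀ z ∈ O, inner ℝ (b 2) (V z) = 0 ∧ inner ℝ (b 3) (V z) = 0 ∧ inner ℝ (b 4) (V z) = 0) ∧
      (∀ z ∈ O, inner ℝ (b 0) (W z) = 0 ∧ inner ℝ (b 1) (W z) = 0 ∧ inner ℝ (b 4) (W z) = 0) ∧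
      (∀ z ∈ O, P z = Real.cos (θ - β (h z)) • V z + Real.sin (θ - β (h z)) • W z) ∧
      (∀ X, fderiv ℝ h q X = 0 → fderiv ℝ V q X = 0 → fderiv ℝ W q X = 0 → X = 0) := by
  obtain ⟨ε, F, r, β, S, O₁, hpr, hO₁, hqO₁, hO₁U, hO₁h⟩ := hp.exists_profile hq
  have hp₁ := hp.mono hO₁ hO₁U
  have hball : ∀ z ∈ O₁, h z ∈ Metric.ball (h q) ε := fun z hz => (hO₁h z hz).1
  have hr₀ : 0 < r (h q) := hpr.r_pos _ (hball q hqO₁)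
  -- `l` and `m` are the principal curvatures in `𝕊³` of the slice through `q`, with respect to the
  -- unit normal `rQ`.
  obtain ⟨l, hl⟩ : ∃ l, l = r (h q) * k₂ q := ⟨_, rfl⟩
  obtain ⟨m, hm⟩ : ∃ m, m = r (h q) * k₃ q := ⟨_, rfl⟩
  have hml : m < l := by rw [hl, hm]; exact mul_lt_mul_of_pos_left hlt hr₀
  -- The only use of `f₁` and `f₂`: `k₁` is determined by the height, hence so are `k₂` and `k₃`.
  have hk : ∀ z ∈ O₁, h z = h q → k₂ z = k₂ q ∧ k₃ z = k₃ q := by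
    intro z hz hzq
    have : k₁ z = k₁ q := by
      rw [hp₁.curvature_eq hpr hO₁h hz, hp₁.curvature_eq hpr hO₁h hqO₁, hzq]
    rw [hf₁ z (hO₁U hz), hf₁ q hq, hf₂ z (hO₁U hz), hf₂ q hq, this]
    exact ⟨rfl, rfl⟩
  set V := twist P Q h r β m with hVdef
  set W := twist P Q h r β l with hWdef
  have hV : ContDiffOn ℝ ∞ V O₁ := contDiffOn_twist hp₁ hpr hball m
  have hW : ContDiffOn ℝ ∞ W O₁ := contDiffOn_twist hp₁ hpr hball l
  have hslice : ∀ z ∈ O₁, h z = h q → ∀ e₁ e₂ e₃,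
      IsPrincipalFrame P Q h σ (k₁ z) (k₂ z) (k₃ z) z e₁ e₂ e₃ →
      fderiv ℝ V z e₃ = 0 ∧ fderiv ℝ W z e₂ = 0 ∧ fderiv ℝ V z e₂ ≠ 0 ∧ fderiv ℝ W z e₃ ≠ 0 := by
    intro z hz hzq e₁ e₂ e₃ he
    have h2 := he.normal₂
    have h3 := he.normal₃
    rw [(hk z hz hzq).1] at h2
    rw [(hk z hz hzq).2] at h3
    rw [hVdef, hWdef, fderiv_twist_slice hp₁ hpr hball m hz hzq he.height₃ h3,
      fderiv_twist_slice hp₁ hpr hball l hz hzq he.height₂ h2,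
      fderiv_twist_slice hp₁ hpr hball m hz hzq he.height₂ h2,
      fderiv_twist_slice hp₁ hpr hball l hz hzq he.height₃ h3, ← hl, ← hm, sub_self, sub_self,
      zero_smul, zero_smul]
    exact ⟨rfl, rfl, smul_ne_zero (sub_ne_zero.2 hml.ne) he.position₂,
      smul_ne_zero (sub_ne_zero.2 hml.ne') he.position₃⟩
  obtain ⟨O, hO, hqO, hOO₁, hpair, hV3, hW3⟩ := exists_product_neighbourhood hO₁ hV hW hp₁.smooth_h
    hqO₁ (fun z hz => by
      obtain ⟨e₁, e₂, e₃, he⟩ := hp₁.frame z hz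
      refine ⟨e₁, ?_, fderiv_twist_height hp₁ hpr hO₁h m hz he,
        fderiv_twist_height hp₁ hpr hO₁h l hz he⟩
      rw [he.height₁]
      linarith [hp₁.σ_lt z hz])
    (fun z hz hzq => by
      obtain ⟨e₁, e₂, e₃, he⟩ := hp₁.frame z hz
      exact ⟨e₂, e₃, he.height₂, he.height₃, hslice z hz hzq e₁ e₂ e₃ he⟩)
  -- The negative sign makes both coefficients of `P` positive at `q`, so that `θ` lies in `(0,
  -- π/2)`.
  obtain ⟨RV, hRV⟩ : ∃ R, R = -Real.sqrt (1 + m ^ 2) := ⟨_, rfl⟩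
  obtain ⟨RW, hRW⟩ : ∃ R, R = Real.sqrt (1 + l ^ 2) := ⟨_, rfl⟩
  have hRV2 : RV ^ 2 = 1 + m ^ 2 := by rw [hRV, neg_sq, Real.sq_sqrt (by positivity)]
  have hRW2 : RW ^ 2 = 1 + l ^ 2 := by rw [hRW, Real.sq_sqrt (by positivity)]
  have hRV0 : RV < 0 := by rw [hRV, neg_lt_zero]; exact Real.sqrt_pos.2 (by positivity)
  have hRW0 : 0 < RW := by rw [hRW]; exact Real.sqrt_pos.2 (by positivity)
  have hVV : ∀ z ∈ O, inner ℝ (V z) (V z) = RV ^ 2 := fun z hz => by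
    rw [hRV2, inner_twist hp₁ hpr hO₁h m m (hOO₁ hz), sq]
  have hWW : ∀ z ∈ O, inner ℝ (W z) (W z) = RW ^ 2 := fun z hz => by
    rw [hRW2, inner_twist hp₁ hpr hO₁h l l (hOO₁ hz), sq]
  obtain ⟨hc, b, hb0, hb2, hb4, hbV, hbW⟩ := exists_adapted_basis (A := V '' O) (B := W '' O)
    (e := dt) inner_dt_self (c := 1 + m * l) hRV0.ne hRW0.ne'
    (by rintro _ ⟨z, hz, rfl⟩; exact hVV z hz) (by rintro _ ⟨z, hz, rfl⟩; exact hWW z hz)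
    (by rintro _ ⟨z, hz, rfl⟩; exact inner_twist_dt hp₁ m (hOO₁ hz))
    (by rintro _ ⟨z, hz, rfl⟩; exact inner_twist_dt hp₁ l (hOO₁ hz))
    (by
      rintro _ ⟨z, hz, rfl⟩ _ ⟨w, hw, rfl⟩
      -- The values of `V` at `z` and of `W` at `w` are both attained at the single point `y`, where
      -- the pointwise formula applies.
      obtain ⟨y, hy, h1, h2⟩ := hpair z hz w hw
      rw [← h1, ← h2]
      exact inner_twist hp₁ hpr hO₁h m l (hOO₁ hy))
    (by
      obtain ⟨x, hx, y, hy, z, hz, h1, h2, h3⟩ := hV3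
      exact ⟨_, ⟨x, hx, rfl⟩, _, ⟨y, hy, rfl⟩, _, ⟨z, hz, rfl⟩, h1, h2, h3⟩)
    (by
      obtain ⟨x, hx, y, hy, z, hz, h1, h2, h3⟩ := hW3
      exact ⟨_, ⟨x, hx, rfl⟩, _, ⟨y, hy, rfl⟩, _, ⟨z, hz, rfl⟩, h1, h2, h3⟩)
    ⟨q, hqO, rfl⟩ ⟨q, hqO, rfl⟩
  -- `hc` says `m l = -1`, and `m < l`.
  have hlpos : 0 < l := by nlinarith
  have hRVl : RV * l = -RW := by
    have h1 : (RV * l) ^ 2 = RW ^ 2 := by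
      rw [mul_pow, hRV2, hRW2]; linear_combination (m * l - 1) * hc
    rcases sq_eq_sq_iff_eq_or_eq_neg.1 h1 with h2 | h2
    · nlinarith
    · exact h2
  have hcosθ : Real.cos (Real.arctan l) = RW⁻¹ := by
    rw [Real.cos_arctan, hRW, one_div]
  have hsinθ : Real.sin (Real.arctan l) = l * RW⁻¹ := by
    rw [Real.sin_arctan, hRW, div_eq_mul_inv]
  have hVd : ∀ z ∈ O, inner ℝ (b 4) (V z) = 0 := fun z hz => by
    rw [hb4, real_inner_comm]; exact inner_twist_dt hp₁ m (hOO₁ hz)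
  have hWd : ∀ z ∈ O, inner ℝ (b 4) (W z) = 0 := fun z hz => by
    rw [hb4, real_inner_comm]; exact inner_twist_dt hp₁ l (hOO₁ hz)
  refine ⟨ε, F, r, β, S, O, fun z => RV⁻¹ • V z, fun z => RW⁻¹ • W z, Real.arctan l, b, hpr, hO,
    hqO, hOO₁.trans hO₁U, fun z hz => hball z (hOO₁ hz), Real.arctan_pos.2 hlpos,
    Real.arctan_lt_pi_div_two l, (hV.mono hOO₁).const_smul _, (hW.mono hOO₁).const_smul _, hb0,
    hb2, hb4, fun z hz => ⟨?_, ?_⟩, fun z hz => ?_, fun z hz => ?_, fun z hz => ?_, ?_⟩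
  · rw [inner_smul_left, inner_smul_right, hVV z hz, conj_trivial]
    field_simp [hRV0.ne]
  · rw [inner_smul_left, inner_smul_right, hWW z hz, conj_trivial]
    field_simp
  · simp only [inner_smul_right, hbV _ ⟨z, hz, rfl⟩, hVd z hz, mul_zero, and_self]
  · simp only [inner_smul_right, hbW _ ⟨z, hz, rfl⟩, hWd z hz, mul_zero, and_self]
  · have hRVi : RV⁻¹ = -(l * RW⁻¹) := by
      have h1 := hRV0.ne
      field_simp
      linarith
    have hmR : m * (l * RW⁻¹) = -RW⁻¹ := by linear_combination RW⁻¹ * hc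
    have hR1 : RW⁻¹ ^ 2 * (1 + l ^ 2) = 1 := by
      rw [← hRW2, ← mul_pow, inv_mul_cancel₀ hRW0.ne', one_pow]
    rw [Real.cos_sub, Real.sin_sub, hcosθ, hsinθ, hRVi]
    simp only [hVdef, hWdef, twist, smul_add, smul_smul]
    set c := Real.cos (β (h z))
    set s := Real.sin (β (h z))
    set R := RW⁻¹
    have hcs : s ^ 2 + c ^ 2 = 1 := Real.sin_sq_add_cos_sq _
    -- The coefficients of `P` and of `Q` after substituting the definitions of `V` and `W`; they
    -- must be `1` and `0`.
    have e1 : (R * c + l * R * s) * (-(l * R) * (-s + m * c)) +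
        (l * R * c - R * s) * (R * (-s + l * c)) = 1 := by
      linear_combination (-(R * c + l * R * s) * c) * hmR + (s ^ 2 + c ^ 2) * hR1 + hcs
    have e2 : (R * c + l * R * s) * (-(l * R) * ((c + m * s) * r (h z))) +
        (l * R * c - R * s) * (R * ((c + l * s) * r (h z))) = 0 := by
      linear_combination (-(R * c + l * R * s) * s * r (h z)) * hmR
    rw [add_add_add_comm, ← add_smul, ← add_smul]
    trans (1 : ℝ) • P z + (0 : ℝ) • Q z
    · simp
    · congr 2
      · rw [← e1]
      · rw [← e2]
  · intro X hhX hVX hWX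
    obtain ⟨e₁, e₂, e₃, he⟩ := hp₁.frame q hqO₁
    obtain ⟨h1, h2, h3, h4⟩ := hslice q hqO₁ rfl e₁ e₂ e₃ he
    have hVd := (hV.contDiffAt (hO₁.mem_nhds hqO₁)).differentiableAt (by simp)
    have hWd := (hW.contDiffAt (hO₁.mem_nhds hqO₁)).differentiableAt (by simp)
    rw [fderiv_fun_const_smul hVd, smul_apply, smul_eq_zero_iff_right
      (inv_ne_zero hRV0.ne)] at hVX
    rw [fderiv_fun_const_smul hWd, smul_apply, smul_eq_zero_iff_right
      (inv_ne_zero hRW0.ne')] at hWX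
    have h5 : 1 - σ q ^ 2 ≠ 0 := by linarith [hp.σ_lt q hq]
    obtain ⟨x, y, z, rfl⟩ := he.span X
    have hx : x = 0 := by
      simpa [he.height₁, he.height₂, he.height₃, h5] using hhX
    have hy : y = 0 := by simpa [hx, h1, h3] using hVX
    have hz : z = 0 := by simpa [hx, hy, h2, h4] using hWX
    simp [hx, hy, hz]

end Torus

/-! ### The coordinates `(s, v, w)`. -/

section TorusChart

variable {U : Set (E 3)} {P Q : E 3 → E 5} {h σ k₁ k₂ k₃ : E 3 → ℝ}

/-- `V` is a unit vector in the plane of `b i` and `b j` with value `b i` at `q`, so its derivative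
there can only point along `b j`. -/
theorem fderiv_eq_zero_of_inner {O : Set (E 3)} (hO : IsOpen O)
    {V : E 3 → E 5} (hV : ContDiffOn ℝ ∞ V O) (b : OrthonormalBasis (Fin 5) ℝ (E 5)) {i j : Fin 5}
    {q : E 3} (hq : q ∈ O) (hi : b i = V q) (h1 : ∀ z ∈ O, inner ℝ (V z) (V z) = 1)
    (hk : ∀ k, k ≠ i → k ≠ j → ∀ z ∈ O, inner ℝ (b k) (V z) = 0) {X : E 3}
    (hX : inner ℝ (b j) (fderiv ℝ V q X) = 0) : fderiv ℝ V q X = 0 := by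
  refine InnerProductSpace.ext_inner_left_basis b.toBasis fun k => ?_
  rw [b.coe_toBasis, inner_zero_right]
  by_cases hki : k = i
  · rw [hki, hi]
    exact inner_fderiv_self_eq_zero hO hV h1 hq X
  by_cases hkj : k = j
  · rw [hkj, hX]
  exact inner_fderiv_eq_zero hO hV (hk k hki hkj) hq X

theorem hasFDerivAt_arcsin_inner {O : Set (E 3)} (hO : IsOpen O) {V : E 3 → E 5}
    (hV : ContDiffOn ℝ ∞ V O) (u : E 5) {q : E 3} (hq : q ∈ O) (hu : inner ℝ u (V q) = 0) :
    HasFDerivAt (fun z => Real.arcsin (inner ℝ u (V z))) ((innerSL ℝ u).comp (fderiv ℝ V q)) q := by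
  have h1 : HasDerivAt Real.arcsin 1 (inner ℝ u (V q)) := by
    rw [hu]
    simpa using Real.hasDerivAt_arcsin (x := 0) (by norm_num) (by norm_num)
  have h2 := h1.comp_hasFDerivAt q (hasFDerivAt_inner_left hO hV u hq)
  rw [one_smul] at h2
  exact h2

/-- The coordinates are `s = S(h)` and the angles `v`, `w` of `V`, `W` on their unit circles; the
profile is `α₂ = S⁻¹`, `α₁ = θ - β ∘ S⁻¹`. The isometry `Φ` takes coordinates in the adapted basis.
-/
theorem IsPrincipalPatch.exists_torus_chart_of_lt (hp : IsPrincipalPatch U P Q h σ k₁ k₂ k₃)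
    {f₁ f₂ : ℝ → ℝ} (hf₁ : ∀ z ∈ U, k₂ z = f₁ (k₁ z)) (hf₂ : ∀ z ∈ U, k₃ z = f₂ (k₁ z))
    {q : E 3} (hq : q ∈ U) (hlt : k₃ q < k₂ q) :
    ∃ (χ : OpenPartialHomeomorph (E 3) (E 3)) (Φ : E 5 ≃ᵃⁱ[ℝ] E 5) (I : Set ℝ) (α₁ α₂ : ℝ → ℝ),
      q ∈ χ.source ∧ χ.source ⊆ U ∧ ContDiffOn ℝ ∞ χ χ.source ∧ ContDiffOn ℝ ∞ χ.symm χ.target ∧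
      Φ '' product = product ∧ IsProfile I α₁ α₂ ∧
      ∀ z ∈ χ.source, χ z 0 ∈ I ∧ Φ (P z + h z • dt) = torusMap α₁ α₂ (χ z) := by
  obtain ⟨ε, F, r, β, S, O, V, W, θ, b, hpr, hO, hqO, hOU, hOh, hθ0, hθ1, hV, hW, hb0, hb2, hb4,
    hunit, hbV, hbW, hP, hinj⟩ := hp.exists_planes hf₁ hf₂ hq hlt
  have hqb : h q ∈ Metric.ball (h q) ε := Metric.mem_ball_self hpr.pos
  -- the arc length parameter
  have hβc : ContinuousOn (fun t => θ - β t) (Metric.ball (h q) ε) :=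
    continuousOn_const.sub hpr.smooth_β.continuousOn
  -- Heights with `cos (θ - β)` and `sin (θ - β)` positive; at `h q` the angle is `θ ∈ (0, π/2)`.
  have hD := (Real.continuous_cos.comp_continuousOn hβc).isOpen_inter_preimage
    Metric.isOpen_ball (isOpen_Ioi (a := 0))
  have hD' := ((Real.continuous_sin.comp_continuousOn hβc).mono
    Set.inter_subset_left).isOpen_inter_preimage hD (isOpen_Ioi (a := 0))
  obtain ⟨ψ, hqψ, hψD, hψ, hψs, hψt⟩ := exists_openPartialHomeomorph hD'
    (hpr.smooth_S.mono fun t ht => ht.1.1) (a := h q)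
    (by
      refine ⟨⟨hqb, ?_⟩, ?_⟩
      · simpa [hpr.β_zero] using Real.cos_pos_of_mem_Ioo ⟨by linarith, hθ1⟩
      · simpa [hpr.β_zero] using Real.sin_pos_of_pos_of_lt_pi hθ0 (by linarith [Real.pi_pos]))
    rfl
    (by
      intro X hX
      rw [(hpr.deriv_S _ hqb).hasFDerivAt.fderiv] at hX
      simpa [(hpr.r_pos _ hqb).ne'] using hX)
  obtain ⟨δ, hδ, hδt⟩ := Metric.isOpen_iff.1 ψ.open_target _ (ψ.map_source hqψ)
  have hsrc : ∀ s ∈ Metric.ball (ψ (h q)) δ, ψ.symm s ∈ ψ.source := fun s hs =>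
    ψ.map_target (hδt hs)
  have hHd : ∀ s ∈ Metric.ball (ψ (h q)) δ, HasDerivAt ψ.symm (r (ψ.symm s))⁻¹ s := by
    intro s hs
    have hm := (hψD (hsrc s hs)).1.1
    refine ψ.hasDerivAt_symm (hδt hs) (hpr.r_pos _ hm).ne' ?_
    rw [show (ψ : ℝ → ℝ) = S from funext hψ]
    exact hpr.deriv_S _ hm
  have hprofile : IsProfile (Metric.ball (ψ (h q)) δ) (fun s => θ - β (ψ.symm s)) ψ.symm := by
    refine ⟨Metric.isOpen_ball, (convex_ball _ _).ordConnected, ?_, hψt.mono hδt, ?_, ?_, ?_⟩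
    · exact contDiffOn_const.sub (hpr.smooth_β.comp (hψt.mono hδt) fun s hs =>
        (hψD (hsrc s hs)).1.1)
    -- `α₁' = -F` and `α₂' = 1/r`, so this is `F² + r⁻² = 1`.
    · intro s hs
      have hm := (hψD (hsrc s hs)).1.1
      have h1 := (((hpr.deriv_β _ hm).comp s (hHd s hs)).const_sub θ).deriv
      have h0 := (hpr.r_pos _ hm).ne'
      rw [(hHd s hs).deriv, show deriv (fun s => θ - β (ψ.symm s)) s = _ from h1]
      have := hpr.r_sq _ hm
      field_simp
      linear_combination -this
    · exact fun s hs => (hψD (hsrc s hs)).1.2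
    · exact fun s hs => (hψD (hsrc s hs)).2
  -- the domain of the coordinates
  have hhs := hp.smooth_h.mono hOU
  have hO₁ := hhs.continuousOn.isOpen_inter_preimage hO
    (ψ.isOpen_inter_preimage (Metric.isOpen_ball (x := ψ (h q)) (ε := δ)))
  have hO₂ := ((contDiffOn_inner_left hV (b 0)).continuousOn.mono
    Set.inter_subset_left).isOpen_inter_preimage hO₁ (isOpen_Ioi (a := 0))
  have hO₃ := ((contDiffOn_inner_left hW (b 2)).continuousOn.mono
    (Set.inter_subset_left.trans Set.inter_subset_left)).isOpen_inter_preimage hO₂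
      (isOpen_Ioi (a := 0))
  -- On the open half circles about `V q = b 0` and `W q = b 2`, `arcsin` of the second component
  -- recovers the angle.
  set D := ((O ∩ h ⁻¹' (ψ.source ∩ ψ ⁻¹' Metric.ball (ψ (h q)) δ)) ∩
    (fun z => inner ℝ (b 0) (V z)) ⁻¹' Set.Ioi 0) ∩ (fun z => inner ℝ (b 2) (W z)) ⁻¹' Set.Ioi 0
  have hDO : D ⊆ O := fun z hz => hz.1.1.1
  have hqD : q ∈ D := by
    refine ⟨⟨⟨hqO, hqψ, Metric.mem_ball_self hδ⟩, ?_⟩, ?_⟩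
    · simp [hb0, (hunit q hqO).1, -inner_self_eq_norm_sq_to_K]
    · simp [hb2, (hunit q hqO).2, -inner_self_eq_norm_sq_to_K]
  have hang : ∀ z ∈ D, inner ℝ (b 0) (V z) ^ 2 + inner ℝ (b 1) (V z) ^ 2 = 1 ∧
      inner ℝ (b 2) (W z) ^ 2 + inner ℝ (b 3) (W z) ^ 2 = 1 := by
    intro z hz
    have h1 := sum_sq_inner b (V z)
    have h2 := sum_sq_inner b (W z)
    obtain ⟨v2, v3, v4⟩ := hbV z (hDO hz)
    obtain ⟨w0, w1, w4⟩ := hbW z (hDO hz)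
    rw [v2, v3, v4, (hunit z (hDO hz)).1] at h1
    rw [w0, w1, w4, (hunit z (hDO hz)).2] at h2
    constructor <;> linarith
  have hv : ∀ z ∈ D, _ := fun z hz => sin_cos_arcsin hz.1.2 (hang z hz).1
  have hw : ∀ z ∈ D, _ := fun z hz => sin_cos_arcsin hz.2 (hang z hz).2
  let f : E 3 → E 3 := fun z => !₂[S (h z), Real.arcsin (inner ℝ (b 1) (V z)),
    Real.arcsin (inner ℝ (b 3) (W z))]
  have hf : ContDiffOn ℝ ∞ f D := by
    rw [contDiffOn_euclidean]
    intro i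
    fin_cases i
    · exact hpr.smooth_S.comp (hhs.mono hDO) fun z hz => hOh z (hDO hz)
    · intro z hz
      exact (Real.contDiffAt_arcsin (hv z hz).2.2.1 (hv z hz).2.2.2).comp_contDiffWithinAt z
        ((contDiffOn_inner_left hV (b 1)).mono hDO z hz)
    · intro z hz
      exact (Real.contDiffAt_arcsin (hw z hz).2.2.1 (hw z hz).2.2.2).comp_contDiffWithinAt z
        ((contDiffOn_inner_left hW (b 3)).mono hDO z hz)
  have hb10 : inner ℝ (b 1) (V q) = 0 := by rw [← hb0]; exact b.inner_eq_zero (by decide)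
  have hb32 : inner ℝ (b 3) (W q) = 0 := by rw [← hb2]; exact b.inner_eq_zero (by decide)
  have hfinj : ∀ X, fderiv ℝ f q X = 0 → X = 0 := by
    intro X hX
    have hfd := ((hf.contDiffAt (hO₃.mem_nhds hqD)).differentiableAt (by simp)).hasFDerivAt
    have hcomp : ∀ (i : Fin 3) (L : E 3 →L[ℝ] ℝ), HasFDerivAt (fun z => f z i) L q → L X = 0 := by
      intro i L hL
      have := hL.unique ((EuclideanSpace.proj i : E 3 →L[ℝ] ℝ).hasFDerivAt.comp q hfd)
      rw [this]
      simp [hX]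
    have hhd := ((hhs.contDiffAt (hO.mem_nhds hqO)).differentiableAt (by simp)).hasFDerivAt
    refine hinj X ?_ ?_ ?_
    · have := hcomp 0 _ ((hpr.deriv_S _ hqb).comp_hasFDerivAt q hhd)
      simpa [(hpr.r_pos _ hqb).ne'] using this
    · refine fderiv_eq_zero_of_inner hO hV b (i := 0) (j := 1) hqO hb0 (fun z hz => (hunit z hz).1)
        (fun k hk hk' z hz => ?_) (hcomp 1 _ (hasFDerivAt_arcsin_inner hO hV (b 1) hqO hb10))
      obtain ⟨v2, v3, v4⟩ := hbV z hz
      fin_cases k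
      exacts [absurd rfl hk, absurd rfl hk', v2, v3, v4]
    · refine fderiv_eq_zero_of_inner hO hW b (i := 2) (j := 3) hqO hb2 (fun z hz => (hunit z hz).2)
        (fun k hk hk' z hz => ?_) (hcomp 2 _ (hasFDerivAt_arcsin_inner hO hW (b 3) hqO hb32))
      obtain ⟨w0, w1, w4⟩ := hbW z hz
      fin_cases k
      exacts [w0, w1, absurd rfl hk, absurd rfl hk', w4]
  obtain ⟨χ, hqχ, hχD, hχ, hχs, hχt⟩ := exists_openPartialHomeomorph hO₃ hf hqD rfl hfinj
  refine ⟨χ, b.repr.toAffineIsometryEquiv, _, _, _, hqχ, hχD.trans (hDO.trans hOU), hχs, hχt,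
    image_product_of_basis b hb4, hprofile, fun z hz => ?_⟩
  have hzD := hχD hz
  have hzh := hzD.1.1.2
  have hs : χ z 0 = ψ (h z) := by rw [hχ, hψ]; rfl
  have h1 : χ z 1 = Real.arcsin (inner ℝ (b 1) (V z)) := by rw [hχ]; rfl
  have h2 : χ z 2 = Real.arcsin (inner ℝ (b 3) (W z)) := by rw [hχ]; rfl
  refine ⟨by rw [hs]; exact hzh.2, ?_⟩
  have hα : ψ.symm (χ z 0) = h z := by rw [hs, ψ.left_inv hzh.1]
  obtain ⟨v2, v3, v4⟩ := hbV z (hDO hzD)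
  obtain ⟨w0, w1, w4⟩ := hbW z (hDO hzD)
  have hbd : ∀ i, i ≠ 4 → inner ℝ (b i) dt = 0 := fun i hi => by
    rw [← hb4]; exact b.inner_eq_zero hi
  ext i
  simp only [LinearIsometryEquiv.coe_toAffineIsometryEquiv, b.repr_apply_apply, torusMap, h1, h2,
    hα, (hv z hzD).1, (hv z hzD).2.1, (hw z hzD).1, (hw z hzD).2.1, inner_add_right,
    inner_smul_right, hP z (hDO hzD)]
  fin_cases i
  · simp [w0, hbd 0 (by decide)]
  · simp [w1, hbd 1 (by decide)]
  · simp [v2, hbd 2 (by decide)]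
  · simp [v3, hbd 3 (by decide)]
  · simp only [Fin.reduceFinMk, v4, w4]
    simp [hb4, inner_dt_self, -inner_self_eq_norm_sq_to_K]

theorem IsPrincipalPatch.exists_torus_chart (hp : IsPrincipalPatch U P Q h σ k₁ k₂ k₃)
    {f₁ f₂ : ℝ → ℝ} (hf₁ : ∀ z ∈ U, k₂ z = f₁ (k₁ z)) (hf₂ : ∀ z ∈ U, k₃ z = f₂ (k₁ z))
    {q : E 3} (hq : q ∈ U) (hne : k₂ q ≠ k₃ q) :
    ∃ (χ : OpenPartialHomeomorph (E 3) (E 3)) (Φ : E 5 ≃ᵃⁱ[ℝ] E 5) (I : Set ℝ) (α₁ α₂ : ℝ → ℝ),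
      q ∈ χ.source ∧ χ.source ⊆ U ∧ ContDiffOn ℝ ∞ χ χ.source ∧ ContDiffOn ℝ ∞ χ.symm χ.target ∧
      Φ '' product = product ∧ IsProfile I α₁ α₂ ∧
      ∀ z ∈ χ.source, χ z 0 ∈ I ∧ Φ (P z + h z • dt) = torusMap α₁ α₂ (χ z) := by
  rcases lt_or_gt_of_ne hne with hlt | hlt
  · exact hp.swap.exists_torus_chart_of_lt hf₂ hf₁ hq hlt
  · exact hp.exists_torus_chart_of_lt hf₁ hf₂ hq hlt

end TorusChart

/-! ### Gauss and Weingarten formulas in a parametrization. -/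

section Patch

/-- The orthogonal projection of `𝔼⁵` to the hyperplane orthogonal to `∂/∂t`. -/
noncomputable def horizontal : E 5 →L[ℝ] E 5 :=
  ContinuousLinearMap.id ℝ (E 5) - (EuclideanSpace.proj 4 : E 5 →L[ℝ] ℝ).smulRight dt

theorem horizontal_apply (y : E 5) : horizontal y = y - y 4 • dt := rfl

theorem outerNormal_eq (y : E 5) : outerNormal y = horizontal y := by
  rw [horizontal_apply]
  ext i
  fin_cases i <;> simp [outerNormal, dt]

theorem dt_four : (dt : E 5) 4 = 1 := by simp [dt]

theorem horizontal_four (y : E 5) : horizontal y 4 = 0 := by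
  simp [horizontal_apply, dt_four]

theorem horizontal_dt : horizontal dt = 0 := by
  simp [horizontal_apply, dt_four]

theorem horizontal_horizontal (y : E 5) : horizontal (horizontal y) = horizontal y := by
  rw [horizontal_apply (horizontal y), horizontal_four, zero_smul, sub_zero]

theorem inner_horizontal_right (y w : E 5) :
    inner ℝ y (horizontal w) = inner ℝ y w - y 4 * w 4 := by
  rw [horizontal_apply, inner_sub_right, inner_smul_right, inner_dt_right, mul_comm]

theorem inner_horizontal_left (y w : E 5) :
    inner ℝ (horizontal y) w = inner ℝ y w - y 4 * w 4 := by
  rw [real_inner_comm, inner_horizontal_right, real_inner_comm, mul_comm]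

/-- The normal space of a `3`-dimensional subspace of `𝔼⁵` is spanned by two orthonormal normal
vectors. -/
theorem eq_smul_of_orthogonal {A : E 3 →L[ℝ] E 5} (hA : Function.Injective A) {n ξ v : E 5}
    (hn : inner ℝ n n = 1) (hξ : inner ℝ ξ ξ = 1) (hnξ : inner ℝ n ξ = 0)
    (hnA : ∀ Y, inner ℝ n (A Y) = 0) (hξA : ∀ Y, inner ℝ ξ (A Y) = 0)
    (hvA : ∀ Y, inner ℝ v (A Y) = 0) (hvn : inner ℝ v n = 0) : v = inner ℝ v ξ • ξ := by
  by_contra hne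
  set w := v - inner ℝ v ξ • ξ with hw
  have hw0 : w ≠ 0 := sub_ne_zero.2 hne
  have hwn : inner ℝ w n = 0 := by
    rw [hw, inner_sub_left, inner_smul_left, hvn, real_inner_comm n ξ, hnξ]; simp
  have hwξ : inner ℝ w ξ = 0 := by
    rw [hw, inner_sub_left, inner_smul_left, hξ]; simp
  have hwA : ∀ Y, inner ℝ w (A Y) = 0 := fun Y => by
    rw [hw, inner_sub_left, inner_smul_left, hvA, hξA]; simp
  have comm : ∀ x y : E 5, inner ℝ x y = 0 → inner ℝ y x = 0 := fun x y h => by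
    rw [real_inner_comm]; exact h
  -- Three independent vectors cannot fit in the two-dimensional orthogonal complement of the range
  -- of `A`.
  have hli : LinearIndependent ℝ ![n, ξ, w] := by
    refine linearIndependent_of_ne_zero_of_inner_eq_zero (𝕜 := ℝ) ?_ ?_
    · intro i
      fin_cases i
      · intro h0; simp [show n = 0 from h0] at hn
      · intro h0; simp [show ξ = 0 from h0] at hξ
      · exact hw0
    · intro i j hij
      fin_cases i <;> fin_cases j <;> first
        | exact absurd rfl hij
        | exact hnξ
        | exact comm _ _ hnξ
        | exact hwn
        | exact hwξ
        | exact comm _ _ hwn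
        | exact comm _ _ hwξ
  set K := LinearMap.range A.toLinearMap
  have hK : Module.finrank ℝ K = 3 := by
    rw [LinearMap.finrank_range_of_inj (f := A.toLinearMap) hA]; simp
  have hsub : Submodule.span ℝ (Set.range ![n, ξ, w]) ≤ Kᗮ := by
    rw [Submodule.span_le]
    rintro _ ⟨i, rfl⟩
    rw [SetLike.mem_coe, Submodule.mem_orthogonal']
    rintro _ ⟨Y, rfl⟩
    fin_cases i
    exacts [hnA Y, hξA Y, hwA Y]
  have h1 := Submodule.finrank_mono hsub
  rw [finrank_span_eq_card hli] at h1
  have h2 := K.finrank_add_finrank_orthogonal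
  rw [hK] at h2
  simp at h1 h2
  omega

variable {U : Set (E 3)} {x N : E 3 → E 5} {k₁ k₂ k₃ : E 3 → ℝ}

/-- The second fundamental form is symmetric. -/
theorem inner_fderiv_symm (hU : IsOpen U) (hx : ContDiffOn ℝ ∞ x U) (hN : ContDiffOn ℝ ∞ N U)
    (hNx : ∀ z ∈ U, ∀ X, inner ℝ (N z) (fderiv ℝ x z X) = 0) {z : E 3} (hz : z ∈ U) (X Y : E 3) :
    inner ℝ (fderiv ℝ N z X) (fderiv ℝ x z Y) = inner ℝ (fderiv ℝ N z Y) (fderiv ℝ x z X) := by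
  have hn := hU.mem_nhds hz
  have hNd := ((hN.contDiffAt hn).differentiableAt (by simp)).hasFDerivAt
  have hxx : DifferentiableAt ℝ (fderiv ℝ x) z :=
    ((hx.contDiffAt hn).fderiv_right (m := 1)
      (WithTop.coe_le_coe.2 (le_top : (1 + 1 : ℕ∞) ≤ ⊤))).differentiableAt (by simp)
  -- Differentiating `⟨N, dx Y⟩ = 0` with `Y` constant reduces the claim to the symmetry of the
  -- second derivative of `x`.
  have key : ∀ X Y, inner ℝ (fderiv ℝ N z X) (fderiv ℝ x z Y) =
      -inner ℝ (N z) (fderiv ℝ (fderiv ℝ x) z X Y) := by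
    intro X Y
    have h1 : HasFDerivAt (fun w => fderiv ℝ x w Y) _ z :=
      hxx.hasFDerivAt.clm_apply (hasFDerivAt_const Y z)
    have h2 := (hNd.inner ℝ h1).fderiv
    have h3 : fderiv ℝ (fun w => inner ℝ (N w) (fderiv ℝ x w Y)) z = 0 := by
      rw [← fderiv_const_apply (x := z) (0 : ℝ)]
      refine Filter.EventuallyEq.fderiv_eq ?_
      filter_upwards [hn] with w hw using hNx w hw Y
    rw [h3] at h2
    have := congrArg (fun L => L X) h2
    simp [fderivInnerCLM_apply] at this
    linarith
  have hsymm : IsSymmSndFDerivAt ℝ x z :=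
    (hx.contDiffAt hn).isSymmSndFDerivAt (by
      rw [minSmoothness_of_isRCLikeNormedField]
      exact WithTop.coe_le_coe.2 le_top)
  rw [key, key, hsymm.eq X Y]

/-- With `ξ` the horizontal part of `x`, the normal space in `𝔼⁵` is spanned by `N` and `ξ`. Hence
`dx T = dt - σ N` and `dN e = -k dx e + σ ⟨dx e, dt⟩ ξ` for principal `e`; the frame equations are
the horizontal parts and last coordinates of these. -/
theorem isPrincipalPatch_of_hypersurface (hU : IsOpen U) (hx : ContDiffOn ℝ ∞ x U)
    (hN : ContDiffOn ℝ ∞ N U) (hxp : ∀ z ∈ U, x z ∈ product) (hN1 : ∀ z ∈ U, ‖N z‖ = 1)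
    (hNξ : ∀ z ∈ U, inner ℝ (N z) (outerNormal (x z)) = 0)
    (hNx : ∀ z ∈ U, ∀ X, inner ℝ (N z) (fderiv ℝ x z X) = 0)
    (hinj : ∀ z ∈ U, Function.Injective (fderiv ℝ x z))
    (h₁₂ : ∀ z ∈ U, k₁ z ≠ k₂ z) (h₁₃ : ∀ z ∈ U, k₁ z ≠ k₃ z) (h₂₃ : ∀ z ∈ U, k₂ z ≠ k₃ z)
    (hframe : ∀ z ∈ U, ∃ e₁ e₂ e₃ : E 3, e₁ ≠ 0 ∧ e₂ ≠ 0 ∧ e₃ ≠ 0 ∧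
      (∀ Y, inner ℝ (dt - fderiv ℝ x z e₁) (fderiv ℝ x z Y) = 0) ∧
      (∀ Y, inner ℝ (fderiv ℝ N z e₁ + k₁ z • fderiv ℝ x z e₁) (fderiv ℝ x z Y) = 0) ∧
      (∀ Y, inner ℝ (fderiv ℝ N z e₂ + k₂ z • fderiv ℝ x z e₂) (fderiv ℝ x z Y) = 0) ∧
      (∀ Y, inner ℝ (fderiv ℝ N z e₃ + k₃ z • fderiv ℝ x z e₃) (fderiv ℝ x z Y) = 0)) :
    IsPrincipalPatch U (fun z => horizontal (x z)) (fun z => horizontal (N z)) (fun z => x z 4)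
      (fun z => N z 4) k₁ k₂ k₃ := by
  have hxP : ContDiffOn ℝ ∞ (fun z => horizontal (x z)) U :=
    horizontal.contDiff.comp_contDiffOn hx
  have hNQ : ContDiffOn ℝ ∞ (fun z => horizontal (N z)) U :=
    horizontal.contDiff.comp_contDiffOn hN
  have hNN : ∀ z ∈ U, inner ℝ (N z) (N z) = 1 := fun z hz => by
    rw [real_inner_self_eq_norm_sq, hN1 z hz, one_pow]
  have hPP : ∀ z ∈ U, inner ℝ (horizontal (x z)) (horizontal (x z)) = 1 := fun z hz => by
    have h1 := (mem_product_iff _).1 (hxp z hz)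
    rw [inner_dt_right] at h1
    rw [inner_horizontal_right, horizontal_four, inner_horizontal_left,
      real_inner_self_eq_norm_sq, h1]
    ring
  have hNP : ∀ z ∈ U, inner ℝ (N z) (horizontal (x z)) = 0 := fun z hz => by
    rw [← outerNormal_eq]; exact hNξ z hz
  -- derivatives
  have hxd : ∀ z ∈ U, HasFDerivAt x (fderiv ℝ x z) z := fun z hz =>
    ((hx.contDiffAt (hU.mem_nhds hz)).differentiableAt (by simp)).hasFDerivAt
  have hNd : ∀ z ∈ U, HasFDerivAt N (fderiv ℝ N z) z := fun z hz =>
    ((hN.contDiffAt (hU.mem_nhds hz)).differentiableAt (by simp)).hasFDerivAt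
  have dP : ∀ z ∈ U, ∀ X, fderiv ℝ (fun z => horizontal (x z)) z X =
      horizontal (fderiv ℝ x z X) := fun z hz X => by
    exact congrArg (fun L => L X) (horizontal.hasFDerivAt.comp z (hxd z hz)).fderiv
  have dQ : ∀ z ∈ U, ∀ X, fderiv ℝ (fun z => horizontal (N z)) z X =
      horizontal (fderiv ℝ N z X) := fun z hz X => by
    exact congrArg (fun L => L X) (horizontal.hasFDerivAt.comp z (hNd z hz)).fderiv
  have dh : ∀ z ∈ U, ∀ X, fderiv ℝ (fun z => x z 4) z X = fderiv ℝ x z X 4 := fun z hz X => by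
    exact congrArg (fun L => L X)
      ((EuclideanSpace.proj 4 : E 5 →L[ℝ] ℝ).hasFDerivAt.comp z (hxd z hz)).fderiv
  have dσ : ∀ z ∈ U, ∀ X, fderiv ℝ (fun z => N z 4) z X = fderiv ℝ N z X 4 := fun z hz X => by
    exact congrArg (fun L => L X)
      ((EuclideanSpace.proj 4 : E 5 →L[ℝ] ℝ).hasFDerivAt.comp z (hNd z hz)).fderiv
  have hPx : ∀ z ∈ U, ∀ X, inner ℝ (horizontal (x z)) (fderiv ℝ x z X) = 0 := fun z hz X => by
    have h1 := inner_fderiv_self_eq_zero hU hxP hPP hz X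
    rw [dP z hz, inner_horizontal_right, horizontal_four] at h1
    linarith
  have hNdN : ∀ z ∈ U, ∀ X, inner ℝ (fderiv ℝ N z X) (N z) = 0 := fun z hz X => by
    rw [real_inner_comm]; exact inner_fderiv_self_eq_zero hU hN hNN hz X
  have hdNP : ∀ z ∈ U, ∀ X, inner ℝ (fderiv ℝ N z X) (horizontal (x z)) =
      N z 4 * fderiv ℝ x z X 4 := fun z hz X => by
    have hPd : HasFDerivAt (fun z => horizontal (x z)) _ z :=
      horizontal.hasFDerivAt.comp z (hxd z hz)
    have h2 := ((hNd z hz).inner ℝ hPd).fderiv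
    have h3 : fderiv ℝ (fun w => inner ℝ (N w) (horizontal (x w))) z = 0 := by
      rw [← fderiv_const_apply (x := z) (0 : ℝ)]
      refine Filter.EventuallyEq.fderiv_eq ?_
      filter_upwards [hU.mem_nhds hz] with w hw using hNP w hw
    rw [h3] at h2
    have h4 := congrArg (fun L => L X) h2
    simp [fderivInnerCLM_apply, inner_horizontal_right (N z) (fderiv ℝ x z X), hNx z hz X] at h4
    linarith
  have hT : ∀ z ∈ U, ∀ e, (∀ Y, inner ℝ (dt - fderiv ℝ x z e) (fderiv ℝ x z Y) = 0) →
      fderiv ℝ x z e = dt - N z 4 • N z := by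
    intro z hz e he
    have hNdt : inner ℝ dt (N z) = N z 4 := by rw [real_inner_comm, inner_dt_right]
    have h1 := eq_smul_of_orthogonal (hinj z hz) (hNN z hz) (hPP z hz) (hNP z hz) (hNx z hz)
      (hPx z hz) (v := dt - fderiv ℝ x z e - N z 4 • N z)
      (fun Y => by rw [inner_sub_left, he, inner_smul_left, hNx z hz]; simp)
      (by rw [inner_sub_left, inner_sub_left, inner_smul_left, hNN z hz, hNdt,
        real_inner_comm, hNx z hz]; simp)
    have h2 : inner ℝ (dt - fderiv ℝ x z e - N z 4 • N z) (horizontal (x z)) = 0 := by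
      rw [inner_sub_left, inner_sub_left, inner_smul_left, hNP z hz, real_inner_comm _ dt,
        inner_dt_right, horizontal_four, real_inner_comm, hPx z hz]
      simp
    rw [h2, zero_smul] at h1
    rw [sub_sub, sub_eq_zero] at h1
    rw [h1]
    abel
  have hS : ∀ z ∈ U, ∀ e, ∀ k : ℝ,
      (∀ Y, inner ℝ (fderiv ℝ N z e + k • fderiv ℝ x z e) (fderiv ℝ x z Y) = 0) →
      fderiv ℝ N z e = -k • fderiv ℝ x z e + (N z 4 * fderiv ℝ x z e 4) • horizontal (x z) := by
    intro z hz e k he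
    have h1 := eq_smul_of_orthogonal (hinj z hz) (hNN z hz) (hPP z hz) (hNP z hz) (hNx z hz)
      (hPx z hz) he (by
        rw [inner_add_left, inner_smul_left, hNdN z hz, real_inner_comm, hNx z hz]; simp)
    have h2 : inner ℝ (fderiv ℝ N z e + k • fderiv ℝ x z e) (horizontal (x z)) =
        N z 4 * fderiv ℝ x z e 4 := by
      rw [inner_add_left, inner_smul_left, hdNP z hz, real_inner_comm, hPx z hz]; simp
    rw [h2] at h1
    rw [← h1]
    module
  -- Self-adjointness of the shape operator makes eigenvectors of distinct eigenvalues orthogonal.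
  have horth : ∀ z ∈ U, ∀ e e' : E 3, ∀ k k' : ℝ, k ≠ k' →
      (∀ Y, inner ℝ (fderiv ℝ N z e + k • fderiv ℝ x z e) (fderiv ℝ x z Y) = 0) →
      (∀ Y, inner ℝ (fderiv ℝ N z e' + k' • fderiv ℝ x z e') (fderiv ℝ x z Y) = 0) →
      inner ℝ (fderiv ℝ x z e) (fderiv ℝ x z e') = 0 := by
    intro z hz e e' k k' hkk he he'
    have h1 := he e'
    have h2 := he' e
    rw [inner_add_left, inner_smul_left, conj_trivial] at h1 h2
    rw [inner_fderiv_symm hU hx hN hNx hz e' e, real_inner_comm (fderiv ℝ x z e)] at h2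
    have h3 : (k - k') * inner ℝ (fderiv ℝ x z e) (fderiv ℝ x z e') = 0 := by linarith
    exact (mul_eq_zero.1 h3).resolve_left (sub_ne_zero.2 hkk)
  -- `T ≠ 0` and `|T|² = 1 - σ²`.
  have hσ2 : ∀ z ∈ U, N z 4 ^ 2 < 1 := by
    intro z hz
    obtain ⟨e₁, -, -, he₁, -, -, hdt, -⟩ := hframe z hz
    have h1 : fderiv ℝ x z e₁ ≠ 0 := fun h0 => he₁ (hinj z hz (by rw [h0, map_zero]))
    have h2 : 0 < inner ℝ (fderiv ℝ x z e₁) (fderiv ℝ x z e₁) := real_inner_self_pos.2 h1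
    rw [hT z hz e₁ hdt] at h2
    simp only [inner_sub_left, inner_sub_right, inner_smul_left, inner_smul_right, hNN z hz,
      inner_dt_right, dt_four, real_inner_comm (N z) dt, conj_trivial] at h2
    nlinarith
  refine ⟨hU, hxP, hNQ, (EuclideanSpace.proj 4 : E 5 →L[ℝ] ℝ).contDiff.comp_contDiffOn hx,
    (EuclideanSpace.proj 4 : E 5 →L[ℝ] ℝ).contDiff.comp_contDiffOn hN, hPP, fun z hz => ?_,
    fun z hz => ?_, fun z hz => ?_, fun z hz => ?_, hσ2, fun z hz => ?_⟩
  · rw [inner_horizontal_right, horizontal_four, inner_horizontal_left, hNN z hz]; ring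
  · rw [inner_horizontal_right, horizontal_four, real_inner_comm, hNP z hz]; ring
  · rw [inner_dt_right, horizontal_four]
  · rw [inner_dt_right, horizontal_four]
  obtain ⟨e₁, e₂, e₃, he₁, he₂, he₃, hdt, hk₁, hk₂, hk₃⟩ := hframe z hz
  have hne : ∀ e, e ≠ 0 → fderiv ℝ x z e ≠ 0 := fun e he h0 =>
    he (hinj z hz (by rw [h0, map_zero]))
  have o12 := horth z hz _ _ _ _ (h₁₂ z hz) hk₁ hk₂
  have o13 := horth z hz _ _ _ _ (h₁₃ z hz) hk₁ hk₃
  have o23 := horth z hz _ _ _ _ (h₂₃ z hz) hk₂ hk₃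
  have hT₁ := hT z hz e₁ hdt
  -- A tangent vector orthogonal to `T` is horizontal, because `T` is the tangential part of `dt`.
  have hfour : ∀ e, inner ℝ (fderiv ℝ x z e₁) (fderiv ℝ x z e) = 0 → fderiv ℝ x z e 4 = 0 := by
    intro e he
    rw [hT₁, inner_sub_left, inner_smul_left, hNx z hz, real_inner_comm, inner_dt_right] at he
    simpa using he
  have f2 := hfour e₂ o12
  have f3 := hfour e₃ o13
  have f1 : fderiv ℝ x z e₁ 4 = 1 - N z 4 ^ 2 := by
    rw [hT₁]; simp [dt_four]; ring
  have s1 := hS z hz e₁ _ hk₁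
  have s2 := hS z hz e₂ _ hk₂
  have s3 := hS z hz e₃ _ hk₃
  rw [f1] at s1
  rw [f2, mul_zero, zero_smul, add_zero] at s2
  rw [f3, mul_zero, zero_smul, add_zero] at s3
  refine ⟨e₁, e₂, e₃, ?_, ?_, ?_, ?_, ?_, ?_, ?_, ?_, ?_, ?_, ?_, ?_, ?_⟩
  · intro X
    have hli : LinearIndependent ℝ ![e₁, e₂, e₃] := by
      refine LinearIndependent.of_comp (fderiv ℝ x z).toLinearMap
        (linearIndependent_of_ne_zero_of_inner_eq_zero (𝕜 := ℝ) ?_ ?_)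
      · intro i
        fin_cases i
        exacts [hne _ he₁, hne _ he₂, hne _ he₃]
      · intro i j hij
        fin_cases i <;> fin_cases j <;> first
          | exact absurd rfl hij
          | exact o12
          | exact o13
          | exact o23
          | exact (real_inner_comm _ _).trans o12
          | exact (real_inner_comm _ _).trans o13
          | exact (real_inner_comm _ _).trans o23
    let B := basisOfLinearIndependentOfCardEqFinrank hli (by simp)
    refine ⟨B.repr X 0, B.repr X 1, B.repr X 2, ?_⟩
    conv_lhs => rw [← B.sum_repr X]
    simp [Fin.sum_univ_three, B]
  · rw [dh z hz, f1]
  · rw [dh z hz, f2]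
  · rw [dh z hz, f3]
  · rw [dσ z hz, s1]; simp [f1, horizontal_four]
  · rw [dσ z hz, s2]; simp [f2]
  · rw [dσ z hz, s3]; simp [f3]
  · rw [dP z hz, hT₁, map_sub, horizontal_dt, map_smul, zero_sub, neg_smul]
  · rw [dP z hz, horizontal_apply, f2, zero_smul, sub_zero]; exact hne _ he₂
  · rw [dP z hz, horizontal_apply, f3, zero_smul, sub_zero]; exact hne _ he₃
  · rw [dQ z hz, s1, hT₁, map_add, map_smul, map_sub, horizontal_dt, map_smul, map_smul,
      horizontal_horizontal]
    module
  · rw [dQ z hz, dP z hz, s2, map_smul]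
  · rw [dQ z hz, dP z hz, s3, map_smul]

end Patch

/-! ### Passage from the manifold to a chart. -/

section Manifold

variable {M : Type*} [TopologicalSpace M] [ChartedSpace (E 3) M]

theorem inner_sub_diff_tangentPart {x : M → E 5} {p : M} (h : Function.Injective (diff x p))
    (v : E 5) (Y : TangentSpace (𝓡 3) p) :
    inner ℝ (v - diff x p (tangentPart x p v)) (diff x p Y) = 0 := by
  rw [diff_tangentPart h]
  exact (Submodule.mem_orthogonal' _ _).1
    (Submodule.sub_starProjection_mem_orthogonal v) _ ⟨Y, rfl⟩

/-- The eigenvector equation tested against tangent vectors: `tangentPart` disappears and only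
differentials remain, which can be read in a chart. -/
theorem inner_add_of_shapeOperator {x N : M → E 5} {p : M} (h : Function.Injective (diff x p))
    {k : ℝ} {X : TangentSpace (𝓡 3) p} (hX : shapeOperator x N p X = k • X)
    (Y : TangentSpace (𝓡 3) p) :
    inner ℝ (diff N p X + k • diff x p X) (diff x p Y) = 0 := by
  have h1 : tangentPart x p (diff N p X) = -(k • X) := by
    rw [← hX]; simp [shapeOperator]
  have h2 := inner_sub_diff_tangentPart h (diff N p X) Y
  rwa [h1, map_neg, map_smul, sub_neg_eq_add] at h2

variable [IsManifold (𝓡 3) ∞ M]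

theorem contDiffOn_comp_chart_symm {f : M → E 5} (hf : ContMDiff (𝓡 3) 𝓘(ℝ, E 5) ∞ f) (p : M) :
    ContDiffOn ℝ ∞ (f ∘ (chartAt (E 3) p).symm) (chartAt (E 3) p).target :=
  (hf.comp_contMDiffOn (contMDiffOn_chart_symm (I := 𝓡 3))).contDiffOn

theorem fderiv_comp_chart_symm {f : M → E 5} (hf : ContMDiff (𝓡 3) 𝓘(ℝ, E 5) ∞ f) (p : M)
    {z : E 3} (hz : z ∈ (chartAt (E 3) p).target) (X : E 3) :
    fderiv ℝ (f ∘ (chartAt (E 3) p).symm) z X = diff f ((chartAt (E 3) p).symm z)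
      (mfderiv (𝓡 3) (𝓡 3) (chartAt (E 3) p).symm z X) := by
  have h1 : MDifferentiableAt (𝓡 3) (𝓡 3) (chartAt (E 3) p).symm z :=
    ((contMDiffOn_chart_symm (I := 𝓡 3) (n := ∞)).contMDiffAt
      ((chartAt (E 3) p).open_target.mem_nhds hz)).mdifferentiableAt (by simp)
  rw [← mfderiv_eq_fderiv, mfderiv_comp z ((hf _).mdifferentiableAt (by simp)) h1]
  rfl

theorem mfderiv_chart_symm_bijective (p : M) {z : E 3} (hz : z ∈ (chartAt (E 3) p).target) :
    Function.Bijective (mfderiv (𝓡 3) (𝓡 3) (chartAt (E 3) p).symm z) := by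
  have : IsManifold (𝓡 3) 1 M := IsManifold.of_le (n := ∞) (by simp)
  exact (mdifferentiable_chart (I := 𝓡 3) p).symm.mfderiv_bijective hz

/-- The derivative of the inverse chart is bijective, so `T` and eigenvectors for `k₂`, `k₃` pull
back to vectors of `𝔼³`. -/
theorem IsOrientedHypersurface.isPrincipalPatch {x N : M → E 5} (hx : IsOrientedHypersurface x N)
    {k₁ k₂ k₃ : M → ℝ}
    (hk₂ : ∀ p, (shapeOperator x N p).HasEigenvalue (k₂ p))
    (hk₃ : ∀ p, (shapeOperator x N p).HasEigenvalue (k₃ p))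
    (h₁₂ : ∀ p, k₁ p ≠ k₂ p) (h₁₃ : ∀ p, k₁ p ≠ k₃ p) (h₂₃ : ∀ p, k₂ p ≠ k₃ p)
    (hT : ∀ p, heightField x p ≠ 0)
    (hST : ∀ p, shapeOperator x N p (heightField x p) = k₁ p • heightField x p) (p : M) :
    IsPrincipalPatch (chartAt (E 3) p).target
      (fun z => horizontal ((x ∘ (chartAt (E 3) p).symm) z))
      (fun z => horizontal ((N ∘ (chartAt (E 3) p).symm) z))
      (fun z => (x ∘ (chartAt (E 3) p).symm) z 4) (fun z => (N ∘ (chartAt (E 3) p).symm) z 4)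
      (k₁ ∘ (chartAt (E 3) p).symm) (k₂ ∘ (chartAt (E 3) p).symm)
      (k₃ ∘ (chartAt (E 3) p).symm) := by
  set c := chartAt (E 3) p
  refine isPrincipalPatch_of_hypersurface c.open_target (contDiffOn_comp_chart_symm hx.smooth p)
    (contDiffOn_comp_chart_symm hx.smooth_normal p) (fun z _ => hx.mem_product _)
    (fun z _ => hx.norm_normal _) (fun z _ => hx.normal_tangent_product _) ?_ ?_
    (fun z _ => h₁₂ _) (fun z _ => h₁₃ _) (fun z _ => h₂₃ _) ?_
  · intro z hz X
    rw [fderiv_comp_chart_symm hx.smooth p hz]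
    exact hx.normal_orthogonal _ _
  · intro z hz X Y hXY
    rw [fderiv_comp_chart_symm hx.smooth p hz, fderiv_comp_chart_symm hx.smooth p hz] at hXY
    exact (mfderiv_chart_symm_bijective p hz).1 (hx.immersion _ hXY)
  · intro z hz
    have hsurj := (mfderiv_chart_symm_bijective p hz).2
    obtain ⟨X₂, hX₂⟩ := (hk₂ (c.symm z)).exists_hasEigenvector
    obtain ⟨X₃, hX₃⟩ := (hk₃ (c.symm z)).exists_hasEigenvector
    obtain ⟨e₁, he₁⟩ : ∃ e : E 3, _ := hsurj (heightField x (c.symm z))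
    obtain ⟨e₂, he₂⟩ : ∃ e : E 3, _ := hsurj X₂
    obtain ⟨e₃, he₃⟩ : ∃ e : E 3, _ := hsurj X₃
    have himm := hx.immersion (c.symm z)
    have hdx : ∀ X, fderiv ℝ (x ∘ c.symm) z X = _ := fderiv_comp_chart_symm hx.smooth p hz
    have hdN : ∀ X, fderiv ℝ (N ∘ c.symm) z X = _ := fderiv_comp_chart_symm hx.smooth_normal p hz
    refine ⟨e₁, e₂, e₃, ?_, ?_, ?_, fun Y => ?_, fun Y => ?_, fun Y => ?_, fun Y => ?_⟩
    · rintro rfl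
      exact hT _ (he₁.symm.trans (map_zero _))
    · rintro rfl
      exact hX₂.2 (he₂.symm.trans (map_zero _))
    · rintro rfl
      exact hX₃.2 (he₃.symm.trans (map_zero _))
    · rw [hdx Y, (hdx e₁).trans (congrArg _ he₁)]
      exact inner_sub_diff_tangentPart himm dt _
    · rw [hdx Y, (hdx e₁).trans (congrArg _ he₁), (hdN e₁).trans (congrArg _ he₁)]
      exact inner_add_of_shapeOperator himm (hST _) _
    · rw [hdx Y, (hdx e₂).trans (congrArg _ he₂), (hdN e₂).trans (congrArg _ he₂)]
      exact inner_add_of_shapeOperator himm hX₂.apply_eq_smul _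
    · rw [hdx Y, (hdx e₃).trans (congrArg _ he₃), (hdN e₃).trans (congrArg _ he₃)]
      exact inner_add_of_shapeOperator himm hX₃.apply_eq_smul _

end Manifold

end S3R

theorem mainTheorem2 {M : Type*} [TopologicalSpace M] [ChartedSpace (S3R.E 3) M]
    [IsManifold (𝓡 3) ∞ M] (x N : M → S3R.E 5) (hx : S3R.IsOrientedHypersurface x N)
    (k₁ k₂ k₃ : M → ℝ)
    (hk₁ : ∀ p, (S3R.shapeOperator x N p).HasEigenvalue (k₁ p))
    (hk₂ : ∀ p, (S3R.shapeOperator x N p).HasEigenvalue (k₂ p))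
    (hk₃ : ∀ p, (S3R.shapeOperator x N p).HasEigenvalue (k₃ p))
    (h₁₂ : ∀ p, k₁ p ≠ k₂ p) (h₁₃ : ∀ p, k₁ p ≠ k₃ p) (h₂₃ : ∀ p, k₂ p ≠ k₃ p)
    (hT : ∀ p, S3R.heightField x p ≠ 0)
    (hST : ∀ p, S3R.shapeOperator x N p (S3R.heightField x p) = k₁ p • S3R.heightField x p)
    (f₁ f₂ : ℝ → ℝ) (hf₁ : ∀ p, k₂ p = f₁ (k₁ p)) (hf₂ : ∀ p, k₃ p = f₂ (k₁ p)) :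
    S3R.LocallyCongruentToTorusMap x := by
  intro p
  have hpatch := hx.isPrincipalPatch hk₂ hk₃ h₁₂ h₁₃ h₂₃ hT hST p
  have hp := mem_chart_source (S3R.E 3) p
  set c := chartAt (S3R.E 3) p with hc
  obtain ⟨χ, Φ, I, α₁, α₂, hq, hχU, hχs, hχt, hΦ, hprof, hχ⟩ :=
    hpatch.exists_torus_chart (f₁ := f₁) (f₂ := f₂) (fun z _ => hf₁ _) (fun z _ => hf₂ _)
      (c.map_source hp) (h₂₃ _)
  refine ⟨c.trans χ, Φ, I, α₁, α₂, ?_, ?_, hΦ, hprof, fun q hq => ?_⟩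
  · refine OpenPartialHomeomorph.mem_maximalAtlas_of_contMDiffOn _ ?_ ?_
    · rw [OpenPartialHomeomorph.coe_trans, OpenPartialHomeomorph.trans_source]
      exact hχs.contMDiffOn.comp
        ((contMDiffOn_chart (I := 𝓡 3)).mono Set.inter_subset_left) fun q hq => hq.2
    · rw [OpenPartialHomeomorph.coe_trans_symm, OpenPartialHomeomorph.trans_target]
      exact (contMDiffOn_chart_symm (I := 𝓡 3)).comp
        (hχt.contMDiffOn.mono Set.inter_subset_left) fun q hq => hq.2
  · rw [OpenPartialHomeomorph.trans_source]
    exact ⟨hp, hq⟩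
  · rw [OpenPartialHomeomorph.trans_source] at hq
    obtain ⟨h1, h2⟩ := hχ (c q) hq.2
    refine ⟨h1, ?_⟩
    rw [OpenPartialHomeomorph.coe_trans, Function.comp_apply, ← h2]
    -- `x` is its horizontal part plus its height times `dt`.
    simp only [S3R.horizontal_apply, Function.comp_apply, c.left_inv hq.1, sub_add_cancel]
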